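/- Let $k\ge 2$. A $k$-clause on $x_1,\dots,x_n$ is a set of $k$ literals on $k$ distinct variables, and $F_k(n,m)$ is the formula of $m$ independent, uniformly random $k$-clauses (out of the $2^k\binom nk$ possible ones). Consider the process with three choices: in each of $m$ steps three independent uniformly random $k$-clauses are presented, and an on-line strategy (which knows the past and current offers, but not the future ones) keeps one of them. "W.h.p." means with probability tending to $1$ as $n\to\infty$, and a formula at density $\alpha$ has $m=\lfloor \alpha n\rfloor$ clauses (none if $\alpha<0$). Put $$p_0=2^{-3k},\qquad p_1=\bigl(2^{-k}(k+1)\bigr)^3-p_0,\qquad p_2=1-p_0-p_1,\qquad \alpha^*=\alpha^*(k)=\frac{1}{p_1+2\sqrt{p_0p_2}} .$$ 1. Consider the strategy that keeps, of the three clauses, one with the largest number of positive literals, breaking ties by any fixed rule that depends only on the three numbers of positive literals. Reduce each kept clause to a 2-clause, chosen independently and uniformly among the pairs of its literals that contain the largest possible number of positive literals. Then, for every $n\ge k$, the 2-clause obtained in one step has $0$, $1$, $2$ positive literals with probability $p_0$, $p_1$, $p_2$, respectively. For every $\alpha<\alpha^*$, the resulting 2-SAT formula at density $\alpha$ is satisfiable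 w.h.p., and the $k$-SAT formula of the kept clauses at density $\alpha$ is satisfiable w.h.p. 2. Three choices suffice to increase the $k$-SAT threshold: there are an on-line strategy with three choices (one of those in part 1) and a density $\alpha<\alpha^*$ such that the formula built by the strategy at density $\alpha$ is satisfiable w.h.p., whereas $F_k(n,\lfloor\beta n\rfloor)$ is unsatisfiable w.h.p. for every $\beta\ge\alpha$. Moreover, if a satisfiability threshold $\alpha_k$ exists (that is, $\Pr[F_k(n,\lfloor\beta n\rfloor)\text{ is satisfiable}]$ tends to $1$ for every $\beta<\alpha_k$ and to $0$ for every $\beta>\alpha_k$), then $\alpha>\alpha_k$. 3. $\alpha^*(3)>4.86$ (in particular $\alpha^*(3)>4.4898$), and $\alpha^*(k)>2^k\ln 2$ for every $k\ge 4$. -/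

import Mathlib

open Filter Topology
open scoped BigOperators

/-- A literal on the variables `x_0, …, x_{n-1}`: `(v, true)` is `x_v`, `(v, false)` is its
negation. -/
abbrev Literal (n : ℕ) : Type := Fin n × Bool

/-- A `k`-clause on `n` variables: `k` literals on `k` distinct variables.  There are
`2 ^ k * n.choose k` of them. -/
abbrev Clause (k n : ℕ) : Type :=
  {c : Finset (Literal n) // c.card = k ∧ ∀ a ∈ c, ∀ b ∈ c, a.1 = b.1 → a = b}

instance Clause.instFintype (k n : ℕ) : Fintype (Clause k n) :=
  Subtype.fintype (fun c : Finset (Literal n) =>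
    c.card = k ∧ ∀ a ∈ c, ∀ b ∈ c, a.1 = b.1 → a = b)

/-- A `k`-SAT formula with `m` clauses on `n` variables. -/
abbrev Formula (k n m : ℕ) : Type := Fin m → Clause k n

/-- Some truth assignment makes at least one literal of each clause true. -/
def Satisfiable {k n m : ℕ} (F : Formula k n m) : Prop :=
  ∃ σ : Fin n → Bool, ∀ i, ∃ l ∈ (F i).1, σ l.1 = l.2

/-- The number of positive literals of a clause. -/
def Clause.numPos {k n : ℕ} (c : Clause k n) : ℕ := (c.1.filter fun l => l.2 = true).card

open Classical in
/-- The probability of `E` for a uniformly random element of the finite set `s`. -/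
noncomputable def probOn {Ω : Type} (s : Finset Ω) (E : Ω → Prop) : ℝ :=
  ((s.filter E).card : ℝ) / (s.card : ℝ)

/-- The probability that `m` independent uniformly random `k`-clauses are jointly satisfiable. -/
noncomputable def randomSatProb (k n m : ℕ) : ℝ :=
  probOn (Finset.univ : Finset (Formula k n m)) Satisfiable

/-- `a` is the satisfiability threshold for random `k`-SAT. -/
def IsSatThreshold (k : ℕ) (a : ℝ) : Prop :=
  (∀ α < a, Tendsto (fun n : ℕ => randomSatProb k n ⌊α * n⌋₊) atTop (𝓝 1)) ∧
  (∀ α > a, Tendsto (fun n : ℕ => randomSatProb k n ⌊α * n⌋₊) atTop (𝓝 0))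

/-- The `t` clauses that are presented in one step. -/
abbrev Offer (t k n : ℕ) : Type := Fin t → Clause k n

/-- An on-line strategy with `t` choices: in each step it selects one of the `t` clauses on offer,
knowing the number of past steps, all past offers (hence also its own past choices), and the
current offer, but not the future offers. -/
abbrev OnlineStrategy (t k n : ℕ) : Type :=
  (i : ℕ) → (Fin i → Offer t k n) → Offer t k n → Fin t

/-- The formula that the strategy builds from a sequence of `m` offers. -/
def OnlineStrategy.formula {t k n m : ℕ} (S : OnlineStrategy t k n)
    (ω : Fin m → Offer t k n) : Formula k n m :=
  fun i => ω i (S i.1 (fun j => ω ⟨j.1, j.2.trans i.2⟩) (ω i))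

/-- The probability that the formula built by the strategy in `m` steps is satisfiable, when all
clauses on offer are independent and uniformly random. -/
noncomputable def OnlineStrategy.satProb {t k n : ℕ} (S : OnlineStrategy t k n) (m : ℕ) : ℝ :=
  probOn (Finset.univ : Finset (Fin m → Offer t k n)) fun ω => Satisfiable (S.formula ω)

/-- The most positive 2-clauses contained in `c`, that is, those with the largest possible number
of positive literals. -/
def mostPositivePairs {k n : ℕ} (c : Clause k n) : Finset (Clause 2 n) :=
  Finset.univ.filter fun d =>
    d.1 ⊆ c.1 ∧ ∀ d' : Clause 2 n, d'.1 ⊆ c.1 → d'.numPos ≤ d.numPos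

/-- The probability that the 2-SAT formula is satisfiable that arises when each clause chosen by
the strategy in `m` steps is replaced, independently, by a uniformly random one among the most
positive 2-clauses contained in it. -/
noncomputable def OnlineStrategy.reducedSatProb {t k n : ℕ} (S : OnlineStrategy t k n)
    (m : ℕ) : ℝ :=
  Finset.expect (Finset.univ : Finset (Fin m → Offer t k n)) fun ω =>
    probOn (Fintype.piFinset fun i => mostPositivePairs (S.formula ω i)) Satisfiable

/-- A tie-breaking rule: given `t` numbers, it points at a largest one. -/
def IsMaxRule {t : ℕ} (r : (Fin t → ℕ) → Fin t) : Prop := ∀ (a : Fin t → ℕ) (j : Fin t), a j ≤ a (r a)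

/-- The nonadaptive strategy that looks only at the numbers of positive literals of the clauses on
offer; it keeps a clause with the most positive literals when `r` satisfies `IsMaxRule`. -/
def mostPositiveStrategy {t : ℕ} (k : ℕ) (r : (Fin t → ℕ) → Fin t) (n : ℕ) :
    OnlineStrategy t k n :=
  fun _ _ o => r fun j => (o j).numPos

/-- The probability that one uniformly random offer, after selecting with `r` and reducing to a
uniformly random most positive 2-clause, gives a 2-clause with exactly `j` positive literals. -/
noncomputable def reducedSignProb {t : ℕ} (k : ℕ) (r : (Fin t → ℕ) → Fin t) (n j : ℕ) : ℝ :=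
  Finset.expect (Finset.univ : Finset (Offer t k n)) fun o =>
    probOn (mostPositivePairs (o (r fun i => (o i).numPos))) fun d => d.numPos = j

/-- `p₀ = 2 ^ (-k t)`. -/
noncomputable def pZero (k t : ℕ) : ℝ := 1 / 2 ^ (k * t)

/-- `p₁ = (2 ^ (-k) (k + 1)) ^ t - p₀`. -/
noncomputable def pOne (k t : ℕ) : ℝ := (((k : ℝ) + 1) / 2 ^ k) ^ t - pZero k t

/-- `p₂ = 1 - p₀ - p₁`. -/
noncomputable def pTwo (k t : ℕ) : ℝ := 1 - pZero k t - pOne k t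

/-- `α* = 1 / (p₁ + 2 √(p₀ p₂))`. -/
noncomputable def alphaStar (k t : ℕ) : ℝ :=
  1 / (pOne k t + 2 * √(pZero k t * pTwo k t))

/-!
The argument combines two first moment bounds for satisfiability with two for unsatisfiability.  All
probabilities are written as `iidProb q m E`, the weight of the words of `m` letters in `E` under a
product law.  The common tool is negative correlation in the occupancy problem
(`iidProb_forall_hit_le`): if the boxes are disjoint sets of clauses, the probability that random
clauses hit all of them is at most the product of the single probabilities.

*Satisfiability.*  Only the numbers of positive literals matter for the strategy, and the three
clauses on offer are independent.  This gives the sign probabilities `p₀, p₁, p₂` of the reduced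
2-clause, and by symmetry under permutations of the variables its law (`reducedLaw_eq_div`).  An
unsatisfiable 2-SAT formula contains a bicycle (`exists_isBicycle`), a walk on distinct variables in
the implication digraph with two further arcs whose ends return to it.  The expected number of
bicycles is governed by the matrix of the expected numbers of positive and negative successors of a
literal.  Its largest eigenvalue is `α * (p₁ + 2 * √(p₀ * p₂))`, with eigenvector `(√p₀, √p₂)`.
Below `alphaStar` this is less than `1`, the sum over the lengths converges, and the two returning
arcs leave a factor `1 / n` (`tendsto_reducedSatProb`).  The kept `k`-clauses contain the 2-clauses,
so that they are satisfiable too.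

*Unsatisfiability for `k ≥ 3`.*  A satisfiable formula has a locally maximal satisfying assignment, in
which every false variable has a clause that prevents it from being flipped.  The expected number of
these tends to `0` at a density below `alphaStar` (`tendsto_randomSatProb_of_lt_one`).

*Unsatisfiability for `k = 2`.*  Here the first moment of assignments is too weak at `alphaStar 2 3`,
which is about `1.68`.  Instead, consider the set `T` of literals that is generated in the
implication digraph by the positive literals of a window of about `n ^ (1 / 4)` variables.  As
`c * exp (1 - c) < 1` for the density `c = 3 / 2`, a first moment bound over the possible sets shows
that `T` has linear size (`iidProb_not_fruitful_le`).  Thus every window has a variable `x` with very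
many consequences.  In a satisfying assignment, all consequences of one such `x` are true or all
these variables are false, and a few additional random clauses exclude both
(`tendsto_randomSatProb_two`).
-/

/-! ### Product laws and the occupancy problem -/

open Classical in
/-- The total weight of the words `F` of length `m` over the alphabet `C` that satisfy `E`, when a
word has the product weight `∏ i, q (F i)`.  If `q` is a probability distribution, this is the
probability of `E` for `m` independent letters with law `q`. -/
noncomputable def iidProb {C : Type*} [Fintype C] (q : C → ℝ) (m : ℕ)
    (E : (Fin m → C) → Prop) : ℝ :=
  ∑ F : Fin m → C, if E F then ∏ i, q (F i) else 0

section iidProb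

variable {C : Type*} [Fintype C] {q : C → ℝ} {m : ℕ}

lemma iidProb_mono (hq : ∀ c, 0 ≤ q c) {E E' : (Fin m → C) → Prop} (h : ∀ F, E F → E' F) :
    iidProb q m E ≤ iidProb q m E' := by
  classical
  refine Finset.sum_le_sum fun F _ => ?_
  have := Finset.prod_nonneg fun i (_ : i ∈ Finset.univ) => hq (F i)
  by_cases h1 : E F
  · simp [h1, h F h1]
  · simp only [h1, if_false]; split_ifs <;> simp [this]

lemma iidProb_true : iidProb q m (fun _ => True) = (∑ c, q c) ^ m := by
  classical
  simp only [iidProb, if_true]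
  rw [← Fintype.piFinset_univ, Finset.sum_prod_piFinset]
  simp

lemma iidProb_le_one (hq : ∀ c, 0 ≤ q c) (hq1 : ∑ c, q c = 1) (E : (Fin m → C) → Prop) :
    iidProb q m E ≤ 1 := by
  refine (iidProb_mono hq (E' := fun _ => True) fun _ _ => trivial).trans ?_
  rw [iidProb_true, hq1, one_pow]

lemma iidProb_add_iidProb_not (E : (Fin m → C) → Prop) :
    iidProb q m E + iidProb q m (fun F => ¬ E F) = (∑ c, q c) ^ m := by
  classical
  rw [← iidProb_true, iidProb, iidProb, iidProb, ← Finset.sum_add_distrib]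
  refine Finset.sum_congr rfl fun F _ => ?_
  by_cases h : E F <;> simp [h]

lemma iidProb_exists_le (hq : ∀ c, 0 ≤ q c) {ι : Type*} (s : Finset ι)
    (E : ι → (Fin m → C) → Prop) :
    iidProb q m (fun F => ∃ a ∈ s, E a F) ≤ ∑ a ∈ s, iidProb q m (E a) := by
  classical
  unfold iidProb
  rw [Finset.sum_comm]
  refine Finset.sum_le_sum fun F _ => ?_
  have hp := Finset.prod_nonneg fun i (_ : i ∈ Finset.univ) => hq (F i)
  have hn : ∀ a ∈ s, 0 ≤ (if E a F then ∏ i, q (F i) else 0) := fun a _ => by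
    split_ifs <;> simp [hp]
  split_ifs with h
  · obtain ⟨a, ha, hE⟩ := h
    have := Finset.single_le_sum hn ha
    simpa [hE] using this
  · exact Finset.sum_nonneg hn

lemma iidProb_succ (E : (Fin (m + 1) → C) → Prop) :
    iidProb q (m + 1) E = ∑ c, q c * iidProb q m (fun F => E (Fin.cons c F)) := by
  classical
  unfold iidProb
  rw [← (Fin.consEquiv (fun _ : Fin (m + 1) => C)).sum_comp, Fintype.sum_prod_type]
  refine Finset.sum_congr rfl fun c _ => ?_
  rw [Finset.mul_sum]
  refine Finset.sum_congr rfl fun F _ => ?_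
  simp [Fin.consEquiv, Fin.prod_univ_succ]

/-- Exposing the first `a` letters before the other `b`. -/
lemma iidProb_add (a b : ℕ) (E : (Fin (a + b) → C) → Prop) :
    iidProb q (a + b) E =
      ∑ F : Fin a → C, (∏ i, q (F i)) * iidProb q b (fun G => E (Fin.append F G)) := by
  classical
  unfold iidProb
  rw [← (Fin.appendEquiv a b).sum_comp, Fintype.sum_prod_type]
  refine Finset.sum_congr rfl fun F _ => ?_
  rw [Finset.mul_sum]
  refine Finset.sum_congr rfl fun G _ => ?_
  simp [Fin.appendEquiv, Fin.prod_univ_add]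

lemma iidProb_mul (r : ℝ) (E : (Fin m → C) → Prop) :
    iidProb (fun c => r * q c) m E = r ^ m * iidProb q m E := by
  classical
  unfold iidProb
  rw [Finset.mul_sum]
  refine Finset.sum_congr rfl fun F _ => ?_
  split_ifs <;> simp [Finset.prod_mul_distrib]

lemma iidProb_forall_mem_and [DecidableEq C] (G : Finset C) (E : (Fin m → C) → Prop) :
    iidProb q m (fun F => (∀ i, F i ∈ G) ∧ E F) =
      iidProb (fun c => if c ∈ G then q c else 0) m E := by
  unfold iidProb
  refine Finset.sum_congr rfl fun F _ => ?_
  by_cases h : ∀ i, F i ∈ G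
  · by_cases hE : E F
    · rw [if_pos ⟨h, hE⟩, if_pos hE]
      exact Finset.prod_congr rfl fun i _ => (if_pos (h i)).symm
    · rw [if_neg fun h => hE h.2, if_neg hE]
  · obtain ⟨i, hi⟩ := not_forall.1 h
    have : ∏ i, (if F i ∈ G then q (F i) else 0) = 0 :=
      Finset.prod_eq_zero (Finset.mem_univ i) (by simp [hi])
    simp [h, this]

lemma iidProb_forall_mem (G : Finset C) :
    iidProb q m (fun F => ∀ i, F i ∈ G) = (∑ c ∈ G, q c) ^ m := by
  classical
  have := iidProb_forall_mem_and (q := q) (m := m) G (fun _ => True)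
  rw [iidProb_true] at this
  simpa [Finset.sum_ite_mem] using this

end iidProb

lemma prod_add_sum_le_prod_add {ι : Type*} [DecidableEq ι] (Z : Finset ι) (u h : ι → ℝ)
    (hu : ∀ z, 0 ≤ u z) (hh : ∀ z, 0 ≤ h z) :
    ∏ z ∈ Z, u z + ∑ z ∈ Z, h z * ∏ y ∈ Z.erase z, u y ≤ ∏ z ∈ Z, (u z + h z) := by
  induction Z using Finset.induction_on with
  | empty => simp
  | insert a Z ha ih =>
    rw [Finset.prod_insert ha, Finset.prod_insert ha, Finset.sum_insert ha,
      Finset.erase_insert ha]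
    have e : ∑ z ∈ Z, h z * ∏ y ∈ (insert a Z).erase z, u y
        = u a * ∑ z ∈ Z, h z * ∏ y ∈ Z.erase z, u y := by
      rw [Finset.mul_sum]
      refine Finset.sum_congr rfl fun z hz => ?_
      have hza : a ≠ z := fun h => ha (h ▸ hz)
      rw [Finset.erase_insert_of_ne hza, Finset.prod_insert (by simp [ha])]
      ring
    have hP : ∏ z ∈ Z, u z ≤ ∏ z ∈ Z, (u z + h z) :=
      Finset.prod_le_prod (fun z _ => hu z) fun z _ => by linarith [hh z]
    rw [e]
    nlinarith [mul_le_mul_of_nonneg_left ih (hu a), mul_le_mul_of_nonneg_left hP (hh a)]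

/-- **Negative correlation in the occupancy problem.**  When `m` independent letters are thrown
into disjoint boxes `A z`, the probability that every box is hit is at most the product of the
probabilities that the single boxes are hit.  The induction on `m` reduces this to
`prod_add_sum_le_prod_add`. -/
lemma iidProb_forall_hit_le {C : Type*} [Fintype C] {q : C → ℝ} (hq : ∀ c, 0 ≤ q c)
    (hq1 : ∑ c, q c = 1) {ι : Type*} (Z : Finset ι) (A : ι → Finset C)
    (hA : (Z : Set ι).PairwiseDisjoint A) (m : ℕ) :
    iidProb q m (fun F => ∀ z ∈ Z, ∃ i, F i ∈ A z) ≤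
      ∏ z ∈ Z, (1 - (1 - ∑ c ∈ A z, q c) ^ m) := by
  classical
  induction m generalizing Z with
  | zero =>
    rcases Z.eq_empty_or_nonempty with rfl | ⟨z, hz⟩
    · simp [iidProb]
    · have : ∀ F : Fin 0 → C, ¬ ∀ z ∈ Z, ∃ i, F i ∈ A z := fun F h => by
        obtain ⟨i, _⟩ := h z hz
        exact i.elim0
      simp only [iidProb, this, if_false, Finset.sum_const_zero]
      exact Finset.prod_nonneg fun z _ => by simp
  | succ m ih =>
    set b : ι → ℝ := fun z => ∑ c ∈ A z, q c with hb
    have hb0 : ∀ z, 0 ≤ b z := fun z => Finset.sum_nonneg fun c _ => hq c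
    have hb1 : ∀ z, b z ≤ 1 := fun z => hq1 ▸ Finset.sum_le_univ_sum_of_nonneg hq
    set u : ι → ℝ := fun z => 1 - (1 - b z) ^ m with hu
    have hu0 : ∀ z, 0 ≤ u z := fun z =>
      sub_nonneg.2 (pow_le_one₀ (by linarith [hb1 z]) (by linarith [hb0 z]))
    have hu1 : ∀ z, u z ≤ 1 := fun z => by
      have : 0 ≤ (1 - b z) ^ m := pow_nonneg (by linarith [hb1 z]) m
      simp only [hu]; linarith
    set D : Finset C := Z.biUnion A with hD
    -- the first letter hits at most one box, and the rest has to hit the others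
    have key : ∀ c, iidProb q m (fun F => ∀ z ∈ Z, ∃ i, (Fin.cons c F : Fin (m + 1) → C) i ∈ A z)
        ≤ (if c ∈ D then 0 else ∏ z ∈ Z, u z) +
          ∑ z ∈ Z, if c ∈ A z then ∏ y ∈ Z.erase z, u y else 0 := by
      intro c
      by_cases hc : c ∈ D
      · obtain ⟨z, hz, hcz⟩ := Finset.mem_biUnion.1 hc
        have h1 : iidProb q m (fun F => ∀ z ∈ Z, ∃ i, (Fin.cons c F : Fin (m + 1) → C) i ∈ A z)
            ≤ ∏ y ∈ Z.erase z, u y := by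
          refine le_trans (iidProb_mono hq ?_) (ih (Z.erase z)
            (hA.subset (by simp)))
          intro F hF y hy
          obtain ⟨hyz, hyZ⟩ := Finset.mem_erase.1 hy
          obtain ⟨i, hi⟩ := hF y hyZ
          refine Fin.cases ?_ ?_ i (motive := fun i => (Fin.cons c F : Fin (m + 1) → C) i ∈ A y → _)
            hi
          · intro h
            exact absurd (show c ∈ A y from h)
              (Finset.disjoint_left.1 (hA (Finset.mem_coe.2 hz) (Finset.mem_coe.2 hyZ) hyz.symm) hcz)
          · intro j h
            exact ⟨j, by simpa using h⟩
        have h2 : ∏ y ∈ Z.erase z, u y ≤ ∑ z ∈ Z, if c ∈ A z then ∏ y ∈ Z.erase z, u y else 0 := by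
          have := Finset.single_le_sum (s := Z)
            (f := fun z => if c ∈ A z then ∏ y ∈ Z.erase z, u y else 0)
            (fun y _ => by
              show 0 ≤ ite _ _ _
              split_ifs
              · exact Finset.prod_nonneg fun y _ => hu0 y
              · exact le_rfl) hz
          simpa [hcz] using this
        simp only [hc, if_true, zero_add]
        exact h1.trans h2
      · have h0 : ∀ z ∈ Z, c ∉ A z := fun z hz h => hc (Finset.mem_biUnion.2 ⟨z, hz, h⟩)
        rw [Finset.sum_eq_zero (fun z hz => by simp [h0 z hz])]
        simp only [hc, if_false, add_zero]
        refine le_trans (iidProb_mono hq ?_) (ih Z hA)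
        intro F hF y hy
        obtain ⟨i, hi⟩ := hF y hy
        refine Fin.cases ?_ ?_ i (motive := fun i => (Fin.cons c F : Fin (m + 1) → C) i ∈ A y → _) hi
        · intro h
          exact absurd h (h0 y hy)
        · intro j h
          exact ⟨j, by simpa using h⟩
    rw [iidProb_succ]
    calc _ ≤ ∑ c, q c * ((if c ∈ D then 0 else ∏ z ∈ Z, u z) +
          ∑ z ∈ Z, if c ∈ A z then ∏ y ∈ Z.erase z, u y else 0) :=
          Finset.sum_le_sum fun c _ => mul_le_mul_of_nonneg_left (key c) (hq c)
      _ = (1 - ∑ z ∈ Z, b z) * ∏ z ∈ Z, u z + ∑ z ∈ Z, b z * ∏ y ∈ Z.erase z, u y := by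
          simp only [mul_add, Finset.sum_add_distrib]
          congr 1
          · have h1 : ∑ z ∈ Z, b z = ∑ c ∈ D, q c := (Finset.sum_biUnion hA).symm
            have h2 : ∑ c ∈ D, q c + ∑ c ∈ Dᶜ, q c = 1 := by
              rw [Finset.sum_add_sum_compl, hq1]
            have h3 : ∑ c, q c * (if c ∈ D then 0 else ∏ z ∈ Z, u z)
                = (∑ c ∈ Dᶜ, q c) * ∏ z ∈ Z, u z := by
              rw [Finset.sum_mul, ← Finset.sum_add_sum_compl D,
                Finset.sum_eq_zero (s := D) (fun c hc => by simp [hc]), zero_add]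
              exact Finset.sum_congr rfl fun c hc => by simp [Finset.mem_compl.1 hc]
            rw [h3, h1, ← h2]; ring
          · simp only [Finset.mul_sum]
            rw [Finset.sum_comm]
            refine Finset.sum_congr rfl fun z _ => ?_
            simp only [mul_ite, mul_zero, hb, Finset.sum_mul]
            rw [Finset.sum_ite_mem, Finset.univ_inter]
      _ = ∏ z ∈ Z, u z + ∑ z ∈ Z, (b z * (1 - u z)) * ∏ y ∈ Z.erase z, u y := by
          rw [sub_mul, one_mul, Finset.sum_mul, sub_add, ← Finset.sum_sub_distrib, sub_eq_add_neg,
            ← Finset.sum_neg_distrib]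
          congr 1
          refine Finset.sum_congr rfl fun z hz => ?_
          rw [← Finset.mul_prod_erase Z u hz]; ring
      _ ≤ ∏ z ∈ Z, (u z + b z * (1 - u z)) :=
          prod_add_sum_le_prod_add Z u _ hu0 fun z =>
            mul_nonneg (hb0 z) (by linarith [hu1 z])
      _ = _ := Finset.prod_congr rfl fun z _ => by simp only [hu]; ring

/-- The occupancy bound for weights that do not add up to `1`. -/
lemma iidProb_forall_hit_le' {C : Type*} [Fintype C] {q : C → ℝ} (hq : ∀ c, 0 ≤ q c) {Γ : ℝ}
    (hΓ : 0 < Γ) (hq1 : ∑ c, q c = Γ) {ι : Type*} (Z : Finset ι) (A : ι → Finset C)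
    (hA : (Z : Set ι).PairwiseDisjoint A) (b : ℝ) (hbΓ : b ≤ Γ)
    (hb : ∀ z ∈ Z, ∑ c ∈ A z, q c ≤ b) (m : ℕ) :
    iidProb q m (fun F => ∀ z ∈ Z, ∃ i, F i ∈ A z) ≤
      Γ ^ m * (1 - (1 - b / Γ) ^ m) ^ Z.card := by
  have e : q = fun c => Γ * (Γ⁻¹ * q c) := by
    funext c; field_simp
  rw [e, iidProb_mul]
  refine mul_le_mul_of_nonneg_left ?_ (by positivity)
  refine (iidProb_forall_hit_le (q := fun c => Γ⁻¹ * q c)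
    (fun c => mul_nonneg (by positivity) (hq c)) ?_ Z A hA m).trans ?_
  · rw [← Finset.mul_sum, hq1, inv_mul_cancel₀ hΓ.ne']
  · rw [← Finset.prod_const]
    have h0 : ∀ z, 0 ≤ ∑ c ∈ A z, q c := fun z => Finset.sum_nonneg fun c _ => hq c
    have h1 : ∀ z ∈ Z, 1 - b / Γ ≤ 1 - ∑ c ∈ A z, Γ⁻¹ * q c := fun z hz => by
      rw [← Finset.mul_sum, div_eq_inv_mul]
      have := mul_le_mul_of_nonneg_left (hb z hz) (inv_nonneg.2 hΓ.le)
      linarith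
    have h2 : 0 ≤ 1 - b / Γ := sub_nonneg.2 ((div_le_one hΓ).2 hbΓ)
    refine Finset.prod_le_prod (fun z hz => sub_nonneg.2 (pow_le_one₀ (h2.trans (h1 z hz)) ?_))
      fun z hz => sub_le_sub_left (pow_le_pow_left₀ h2 (h1 z hz) m) 1
    rw [← Finset.mul_sum]
    have := mul_nonneg (inv_nonneg.2 hΓ.le) (h0 z)
    linarith

/-- The union bound for hitting a box of weight `b`. -/
lemma one_sub_one_sub_pow_le {b : ℝ} (hb : b ≤ 1) (m : ℕ) : 1 - (1 - b) ^ m ≤ m * b := by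
  have := one_add_mul_le_pow (a := -b) (by linarith) m
  rw [← sub_eq_add_neg] at this
  linarith

/-! ### Counting clauses -/

/-- The variables of a clause. -/
def Clause.vars {k n : ℕ} (c : Clause k n) : Finset (Fin n) := c.1.image Prod.fst

/-- The clause on the variable set `S` in which the variable `v` has the sign `s v`. -/
def Clause.ofSign {k n : ℕ} (S : Finset (Fin n)) (s : Fin n → Bool) (hS : S.card = k) :
    Clause k n :=
  ⟨S.image fun v => (v, s v), by
    rw [Finset.card_image_of_injective _ fun a b h => (Prod.mk.inj h).1, hS], by
    intro a ha b hb hab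
    obtain ⟨v, -, rfl⟩ := Finset.mem_image.1 ha
    obtain ⟨w, -, rfl⟩ := Finset.mem_image.1 hb
    simp only at hab
    rw [hab]⟩

section Clause

variable {k n : ℕ}

lemma Clause.card_vars (c : Clause k n) : c.vars.card = k := by
  rw [Clause.vars, Finset.card_image_of_injOn, c.2.1]
  exact fun a ha b hb h => c.2.2 a ha b hb h

lemma Clause.mem_ofSign {S : Finset (Fin n)} {s : Fin n → Bool} {hS : S.card = k}
    {l : Literal n} : l ∈ (Clause.ofSign S s hS).1 ↔ l.1 ∈ S ∧ l.2 = s l.1 := by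
  obtain ⟨v, b⟩ := l
  simp only [Clause.ofSign, Finset.mem_image, Prod.mk.injEq]
  constructor
  · rintro ⟨w, hw, rfl, rfl⟩
    exact ⟨hw, rfl⟩
  · rintro ⟨h, h'⟩
    exact ⟨v, h, rfl, h'.symm⟩

lemma Clause.vars_ofSign (S : Finset (Fin n)) (s : Fin n → Bool) (hS : S.card = k) :
    (Clause.ofSign S s hS).vars = S := by
  ext v
  simp only [Clause.vars, Finset.mem_image, Clause.mem_ofSign]
  constructor
  · rintro ⟨l, h, rfl⟩
    exact h.1
  · exact fun h => ⟨(v, s v), ⟨h, rfl⟩, rfl⟩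

lemma Clause.eq_ofSign (c : Clause k n) (s : Fin n → Bool) (h : ∀ l ∈ c.1, l.2 = s l.1) :
    c = Clause.ofSign c.vars s c.card_vars := by
  apply Subtype.ext
  ext l
  rw [Clause.mem_ofSign]
  constructor
  · exact fun hl => ⟨Finset.mem_image_of_mem _ hl, h l hl⟩
  · rintro ⟨h1, h2⟩
    obtain ⟨l', hl', e⟩ := Finset.mem_image.1 h1
    have : l = l' := Prod.ext e.symm (by rw [h2, h l' hl', e])
    rwa [this]

/-- The number of `k`-clauses all of whose signs are prescribed by `s`. -/
lemma Clause.card_filter_sign (s : Fin n → Bool) :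
    (Finset.univ.filter fun c : Clause k n => ∀ l ∈ c.1, l.2 = s l.1).card = n.choose k := by
  have h : (Finset.powersetCard k (Finset.univ : Finset (Fin n))).card = n.choose k := by simp
  rw [← h]
  refine Finset.card_bij (fun c _ => c.vars) (fun c _ => ?_) (fun c hc d hd h => ?_)
    (fun S hS => ?_)
  · simp [Finset.mem_powersetCard, c.card_vars]
  · rw [Finset.mem_filter] at hc hd
    apply Subtype.ext
    have e1 := congrArg Subtype.val (c.eq_ofSign s hc.2)
    have e2 := congrArg Subtype.val (d.eq_ofSign s hd.2)
    rw [e1, e2]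
    simp only [Clause.ofSign, h]
  · have hS' := (Finset.mem_powersetCard.1 hS).2
    refine ⟨Clause.ofSign S s hS', ?_, Clause.vars_ofSign _ _ _⟩
    simp only [Finset.mem_filter, Finset.mem_univ, true_and, Clause.mem_ofSign]
    exact fun l hl => hl.2

/-- Among them, the clauses that contain the variable `x`. -/
lemma Clause.card_filter_sign_mem_le (s : Fin n → Bool) (x : Fin n) :
    (Finset.univ.filter fun c : Clause k n =>
      x ∈ c.vars ∧ ∀ l ∈ c.1, l.2 = s l.1).card ≤ (n - 1).choose (k - 1) := by
  have h : (Finset.powersetCard (k - 1) ((Finset.univ : Finset (Fin n)).erase x)).card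
      = (n - 1).choose (k - 1) := by simp
  rw [← h]
  refine Finset.card_le_card_of_injOn (fun c => c.vars.erase x) (fun c hc => ?_)
    (fun c hc d hd h => ?_)
  · simp only [Finset.coe_filter, Finset.mem_univ, true_and, Set.mem_ofPred_eq] at hc
    rw [Finset.mem_coe, Finset.mem_powersetCard, Finset.card_erase_of_mem hc.1, c.card_vars]
    exact ⟨Finset.erase_subset_erase _ (Finset.subset_univ _), rfl⟩
  · simp only [Finset.coe_filter, Finset.mem_univ, true_and, Set.mem_ofPred_eq] at hc hd
    have hv : c.vars = d.vars := by
      rw [← Finset.insert_erase hc.1, ← Finset.insert_erase hd.1]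
      simp only at h
      rw [h]
    apply Subtype.ext
    have e1 := congrArg Subtype.val (c.eq_ofSign s hc.2)
    have e2 := congrArg Subtype.val (d.eq_ofSign s hd.2)
    rw [e1, e2]
    simp only [Clause.ofSign, hv]

lemma Clause.card_filter_numPos (j : ℕ) :
    (Finset.univ.filter fun c : Clause k n => c.numPos = j).card = n.choose k * k.choose j := by
  classical
  -- a clause amounts to its set of variables `S` and the set `P ⊆ S` of the positive ones
  have h : ((Finset.powersetCard k (Finset.univ : Finset (Fin n))).sigma
      fun S => Finset.powersetCard j S).card = n.choose k * k.choose j := by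
    rw [Finset.card_sigma, Finset.sum_congr rfl (g := fun _ => k.choose j)]
    · simp
    · intro S hS
      rw [Finset.card_powersetCard, (Finset.mem_powersetCard.1 hS).2]
  rw [← h]
  symm
  refine Finset.card_bij
    (fun p hp => Clause.ofSign p.1 (fun v => decide (v ∈ p.2))
      (Finset.mem_powersetCard.1 (Finset.mem_sigma.1 hp).1).2) ?_ ?_ ?_
  · rintro ⟨S, P⟩ hp
    obtain ⟨h1, h2⟩ := Finset.mem_sigma.1 hp
    obtain ⟨h3, h4⟩ := Finset.mem_powersetCard.1 h2
    simp only at h3 h4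
    refine Finset.mem_filter.2 ⟨Finset.mem_univ _, Eq.trans (Eq.symm ?_) h4⟩
    refine Finset.card_bij (fun v _ => (v, true)) ?_ ?_ ?_
    · intro v hv
      rw [Finset.mem_filter, Clause.mem_ofSign]
      simp [hv, h3 hv]
    · intro a _ b _ h
      exact (Prod.mk.inj h).1
    · rintro ⟨v, b⟩ hv
      rw [Finset.mem_filter, Clause.mem_ofSign] at hv
      obtain ⟨⟨h5, h6⟩, h7⟩ := hv
      simp only at h7 h6
      subst h7
      exact ⟨v, by simpa using h6.symm, rfl⟩
  · rintro ⟨S, P⟩ hp ⟨S', P'⟩ hp' h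
    have hS : S = S' := by
      have := congrArg Clause.vars h
      rwa [Clause.vars_ofSign, Clause.vars_ofSign] at this
    subst hS
    obtain ⟨-, h2⟩ := Finset.mem_sigma.1 hp
    obtain ⟨h3, -⟩ := Finset.mem_powersetCard.1 h2
    obtain ⟨-, h2'⟩ := Finset.mem_sigma.1 hp'
    obtain ⟨h3', -⟩ := Finset.mem_powersetCard.1 h2'
    simp only at h3 h3'
    have key : ∀ v, v ∈ S → (v ∈ P ↔ v ∈ P') := fun v hv => by
      have e := congrArg (fun c : Clause k n => (v, true) ∈ c.1) h
      simp only [Clause.mem_ofSign, hv, true_and, eq_iff_iff] at e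
      simpa [eq_comm] using e
    have : P = P' := by
      ext v
      exact ⟨fun hv => (key v (h3 hv)).1 hv, fun hv => (key v (h3' hv)).2 hv⟩
    rw [this]
  · intro c hc
    have hc' : c.numPos = j := by simpa using hc
    set P : Finset (Fin n) := c.vars.filter fun v => (v, true) ∈ c.1 with hP
    have hPc : P.card = j := by
      rw [← hc', Clause.numPos]
      refine Finset.card_bij (fun v _ => (v, true)) ?_ ?_ ?_
      · intro v hv
        rw [Finset.mem_filter]
        exact ⟨(Finset.mem_filter.1 hv).2, rfl⟩
      · intro a _ b _ h
        exact (Prod.mk.inj h).1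
      · rintro ⟨v, b⟩ hv
        obtain ⟨h5, h6⟩ := Finset.mem_filter.1 hv
        simp only at h6
        subst h6
        exact ⟨v, Finset.mem_filter.2 ⟨Finset.mem_image_of_mem Prod.fst h5, h5⟩, rfl⟩
    refine ⟨⟨c.vars, P⟩, ?_, ?_⟩
    · rw [Finset.mem_sigma]
      exact ⟨Finset.mem_powersetCard.2 ⟨Finset.subset_univ _, c.card_vars⟩,
        Finset.mem_powersetCard.2 ⟨Finset.filter_subset _ _, hPc⟩⟩
    · refine (c.eq_ofSign (fun v => decide (v ∈ P)) ?_).symm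
      rintro ⟨v, b⟩ hl
      have hv : v ∈ c.vars := Finset.mem_image_of_mem Prod.fst hl
      simp only [hP, Finset.mem_filter, hv, true_and]
      cases b
      · refine (decide_eq_false fun h => ?_).symm
        have := c.2.2 _ hl _ h rfl
        simp at this
      · simp [hl]

lemma Clause.numPos_le (c : Clause k n) : c.numPos ≤ k :=
  (Finset.card_filter_le _ _).trans c.2.1.le

lemma Clause.card_eq : Fintype.card (Clause k n) = n.choose k * 2 ^ k := by
  rw [← Finset.card_univ, Finset.card_eq_sum_card_fiberwise (f := Clause.numPos)
    (t := Finset.range (k + 1)) (fun c _ => by simpa using Nat.lt_succ_of_le c.numPos_le)]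
  simp only [Clause.card_filter_numPos]
  rw [← Finset.mul_sum, Nat.sum_range_choose]

lemma Clause.card_pos (h : k ≤ n) : 0 < Fintype.card (Clause k n) := by
  rw [Clause.card_eq]
  exact Nat.mul_pos (Nat.choose_pos h) (by positivity)

end Clause

/-- The uniform distribution on clauses. -/
noncomputable def unifClause (k n : ℕ) : Clause k n → ℝ := fun _ => 1 / Fintype.card (Clause k n)

lemma unifClause_nonneg (k n : ℕ) (c : Clause k n) : 0 ≤ unifClause k n c := by
  unfold unifClause; positivity

lemma sum_unifClause {k n : ℕ} (h : k ≤ n) : ∑ c, unifClause k n c = 1 := by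
  have := Clause.card_pos h
  have h' : (Fintype.card (Clause k n) : ℝ) ≠ 0 := by positivity
  simp only [unifClause, Finset.sum_const, Finset.card_univ, nsmul_eq_mul]
  field_simp

lemma sum_unifClause_finset {k n : ℕ} (D : Finset (Clause k n)) :
    ∑ c ∈ D, unifClause k n c = D.card / Fintype.card (Clause k n) := by
  simp [unifClause, div_eq_mul_inv]

lemma randomSatProb_eq_iidProb (k n m : ℕ) :
    randomSatProb k n m = iidProb (unifClause k n) m Satisfiable := by
  classical
  unfold randomSatProb probOn iidProb unifClause
  rw [← Finset.sum_filter]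
  simp only [Finset.prod_const, Finset.sum_const, nsmul_eq_mul, Finset.card_univ,
    Fintype.card_fun, Fintype.card_fin]
  rw [div_pow, one_pow, div_eq_mul_one_div]
  push_cast
  congr!

lemma randomSatProb_nonneg (k n m : ℕ) : 0 ≤ randomSatProb k n m := by
  unfold randomSatProb probOn; positivity

lemma Satisfiable.of_append {k n a b : ℕ} {F : Formula k n a} {G : Formula k n b}
    (h : Satisfiable (k := k) (Fin.append F G)) : Satisfiable F := by
  obtain ⟨σ, hσ⟩ := h
  exact ⟨σ, fun i => by simpa using hσ (Fin.castAdd b i)⟩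

lemma randomSatProb_antitone {k n : ℕ} (h : k ≤ n) : Antitone (randomSatProb k n) := by
  classical
  intro a m ham
  obtain ⟨b, rfl⟩ := Nat.exists_eq_add_of_le ham
  rw [randomSatProb_eq_iidProb, randomSatProb_eq_iidProb, iidProb_add, iidProb]
  refine Finset.sum_le_sum fun F _ => ?_
  have hp : 0 ≤ ∏ i, unifClause k n (F i) := Finset.prod_nonneg fun i _ => unifClause_nonneg _ _ _
  split_ifs with hF
  · exact mul_le_of_le_one_right hp
      (iidProb_le_one (unifClause_nonneg k n) (sum_unifClause h) _)
  · rw [iidProb, Finset.sum_eq_zero, mul_zero]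
    intro G _
    rw [if_neg fun h => hF h.of_append]

/-! ### Locally maximal satisfying assignments -/

/-- The clauses whose only true literal under `σ` is the one on the variable `x`: the sign of `x`
agrees with `σ`, all other signs disagree. -/
def criticalClauses {k n : ℕ} (σ : Fin n → Bool) (x : Fin n) : Finset (Clause k n) :=
  Finset.univ.filter fun c =>
    x ∈ c.vars ∧ ∀ l ∈ c.1, l.2 = if l.1 = x then σ l.1 else !σ l.1

/-- The clauses with a true literal under `σ`. -/
def satisfiedClauses {k n : ℕ} (σ : Fin n → Bool) : Finset (Clause k n) :=
  Finset.univ.filter fun c => ∃ l ∈ c.1, σ l.1 = l.2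

/-- Among the satisfying assignments of a formula, one with the most true variables is locally
maximal: no false variable can be flipped, as each has a critical clause. -/
lemma Satisfiable.exists_forall_critical {k n m : ℕ} {F : Formula k n m} (h : Satisfiable F) :
    ∃ σ : Fin n → Bool, (∀ i, F i ∈ satisfiedClauses σ) ∧
      ∀ x ∈ Finset.univ.filter (fun x => σ x = false), ∃ i, F i ∈ criticalClauses σ x := by
  classical
  obtain ⟨σ₀, h₀⟩ := h
  obtain ⟨σ, hσ, hmax⟩ := Finset.exists_max_image
    (Finset.univ.filter fun σ : Fin n → Bool => ∀ i, ∃ l ∈ (F i).1, σ l.1 = l.2)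
    (fun σ => (Finset.univ.filter fun x => σ x = true).card)
    ⟨σ₀, Finset.mem_filter.2 ⟨Finset.mem_univ _, h₀⟩⟩
  have hσ' := (Finset.mem_filter.1 hσ).2
  refine ⟨σ, fun i => Finset.mem_filter.2 ⟨Finset.mem_univ _, hσ' i⟩, fun x hx => ?_⟩
  have hx' : σ x = false := (Finset.mem_filter.1 hx).2
  have hlt : (Finset.univ.filter fun y => σ y = true).card <
      (Finset.univ.filter fun y => Function.update σ x true y = true).card := by
    refine Finset.card_lt_card (Finset.ssubset_iff_of_subset ?_ |>.2 ⟨x, by simp, by simp [hx']⟩)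
    intro y hy
    have hy' : σ y = true := by simpa using hy
    by_cases hyx : y = x
    · simp [hyx]
    · simp [hyx, hy']
  have hn : ¬ ∀ i, ∃ l ∈ (F i).1, Function.update σ x true l.1 = l.2 := fun h =>
    absurd (hmax _ (Finset.mem_filter.2 ⟨Finset.mem_univ _, h⟩)) (not_le.2 hlt)
  push Not at hn
  obtain ⟨i, hi⟩ := hn
  refine ⟨i, Finset.mem_filter.2 ⟨Finset.mem_univ _, ?_, ?_⟩⟩
  · obtain ⟨l, hl, hle⟩ := hσ' i
    have : l.1 = x := by
      by_contra hne
      exact hi l hl (by rw [Function.update_of_ne hne]; exact hle)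
    exact Finset.mem_image.2 ⟨l, hl, this⟩
  · intro l hl
    have := hi l hl
    by_cases hlx : l.1 = x
    · simp only [hlx, Function.update_self, if_true, hx'] at this ⊢
      simpa using this.symm
    · rw [Function.update_of_ne hlx] at this
      rw [if_neg hlx]
      cases h1 : σ l.1 <;> cases h2 : l.2 <;> simp_all

lemma pairwiseDisjoint_criticalClauses {k n : ℕ} (σ : Fin n → Bool) (Z : Set (Fin n)) :
    Z.PairwiseDisjoint (criticalClauses (k := k) σ) := by
  intro x _ y _ hxy
  refine Finset.disjoint_left.2 fun c hx hy => ?_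
  obtain ⟨-, hx1, hx2⟩ := Finset.mem_filter.1 hx
  obtain ⟨-, -, hy2⟩ := Finset.mem_filter.1 hy
  obtain ⟨l, hl, rfl⟩ := Finset.mem_image.1 hx1
  have h1 := hx2 l hl
  have h2 := hy2 l hl
  rw [if_pos rfl] at h1
  rw [if_neg hxy, h1] at h2
  simp at h2

lemma card_satisfiedClauses_add {k n : ℕ} (σ : Fin n → Bool) :
    (satisfiedClauses (k := k) σ).card + n.choose k = n.choose k * 2 ^ k := by
  classical
  rw [← Clause.card_eq, ← Finset.card_univ, ← Clause.card_filter_sign (k := k) (fun v => !σ v),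
    satisfiedClauses,
    ← Finset.card_filter_add_card_filter_not (s := (Finset.univ : Finset (Clause k n)))
      (fun c => ∃ l ∈ c.1, σ l.1 = l.2)]
  congr 2
  refine Finset.filter_congr fun c _ => ?_
  push Not
  refine forall₂_congr fun l _ => ?_
  cases σ l.1 <;> cases l.2 <;> simp

/-- The first moment of the number of locally maximal satisfying assignments. -/
lemma randomSatProb_le {k n : ℕ} (hk : 1 ≤ k) (hkn : k ≤ n) (m : ℕ) :
    randomSatProb k n m ≤
      (1 - 1 / 2 ^ k) ^ m * (2 - (1 - k / (2 ^ k - 1) / n) ^ m) ^ n := by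
  classical
  have hn : (0 : ℝ) < n := by exact_mod_cast (show 0 < n by omega)
  have h2 : (2 : ℝ) ≤ 2 ^ k := by
    calc (2 : ℝ) = 2 ^ 1 := by norm_num
      _ ≤ 2 ^ k := pow_le_pow_right₀ (by norm_num) hk
  have hch : (0 : ℝ) < n.choose k := by exact_mod_cast Nat.choose_pos hkn
  have hcard : (Fintype.card (Clause k n) : ℝ) = n.choose k * 2 ^ k := by
    rw [Clause.card_eq]; push_cast; ring
  have hch1 : (((n - 1).choose (k - 1) : ℕ) : ℝ) / n.choose k = k / n := by
    have := Nat.add_one_mul_choose_eq (n - 1) (k - 1)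
    rw [Nat.sub_add_cancel (by omega), Nat.sub_add_cancel hk] at this
    rw [div_eq_div_iff hch.ne' hn.ne']
    have h' : (n : ℝ) * ((n - 1).choose (k - 1) : ℕ) = n.choose k * k := by exact_mod_cast this
    linarith
  set Γ : ℝ := 1 - 1 / 2 ^ k with hΓ
  have hΓ0 : 0 < Γ := by
    have : (1 : ℝ) / 2 ^ k ≤ 1 / 2 := one_div_le_one_div_of_le (by norm_num) h2
    linarith
  set b : ℝ := k / n / 2 ^ k with hb
  have hbΓ : b ≤ Γ := by
    have h1 : (k : ℝ) / n ≤ 1 := (div_le_one hn).2 (by exact_mod_cast hkn)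
    have h3 : b ≤ 1 / 2 ^ k := div_le_div_of_nonneg_right h1 (by positivity)
    have : (1 : ℝ) / 2 ^ k ≤ 1 / 2 := one_div_le_one_div_of_le (by norm_num) h2
    linarith
  have hbd : b / Γ = k / (2 ^ k - 1) / n := by
    have h3 : (2 : ℝ) ^ k - 1 ≠ 0 := by linarith
    have h4 : Γ = (2 ^ k - 1) / 2 ^ k := by rw [hΓ]; field_simp
    rw [hb, h4]; field_simp
  have hq := unifClause_nonneg k n
  -- given `σ`, the critical clauses of the false variables are disjoint boxes of weight at most `b`
  -- among the satisfied clauses, which have weight `Γ`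
  have key : ∀ σ : Fin n → Bool,
      iidProb (unifClause k n) m (fun F => (∀ i, F i ∈ satisfiedClauses σ) ∧
        ∀ x ∈ Finset.univ.filter (fun x => σ x = false), ∃ i, F i ∈ criticalClauses σ x) ≤
      Γ ^ m * (1 - (1 - b / Γ) ^ m) ^ (Finset.univ.filter (fun x => σ x = false)).card := by
    intro σ
    rw [iidProb_forall_mem_and]
    refine iidProb_forall_hit_le' (fun c => by split_ifs <;> simp [hq c]) hΓ0 ?_ _ _
      (pairwiseDisjoint_criticalClauses σ _) b hbΓ (fun x _ => ?_) m
    · rw [Finset.sum_ite_mem, Finset.univ_inter, sum_unifClause_finset, hcard,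
        div_eq_iff (by positivity), hΓ]
      have := card_satisfiedClauses_add (k := k) σ
      have h' : ((satisfiedClauses (k := k) σ).card : ℝ) + n.choose k = n.choose k * 2 ^ k := by
        exact_mod_cast this
      field_simp
      linarith
    · calc _ ≤ ∑ c ∈ criticalClauses σ x, unifClause k n c :=
            Finset.sum_le_sum fun c _ => by split_ifs <;> simp [hq c]
        _ ≤ b := by
            rw [sum_unifClause_finset, hcard, hb, ← hch1, div_div]
            refine div_le_div_of_nonneg_right ?_ (by positivity)
            have := Clause.card_filter_sign_mem_le (k := k)
              (fun v => if v = x then σ v else !σ v) x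
            exact_mod_cast this
  rw [randomSatProb_eq_iidProb]
  calc iidProb (unifClause k n) m Satisfiable
      ≤ iidProb (unifClause k n) m (fun F => ∃ σ ∈ (Finset.univ : Finset (Fin n → Bool)),
          (∀ i, F i ∈ satisfiedClauses σ) ∧
          ∀ x ∈ Finset.univ.filter (fun x => σ x = false), ∃ i, F i ∈ criticalClauses σ x) :=
        iidProb_mono hq fun F hF => by
          obtain ⟨σ, hσ⟩ := hF.exists_forall_critical
          exact ⟨σ, Finset.mem_univ _, hσ⟩
    _ ≤ ∑ σ : Fin n → Bool,
          Γ ^ m * (1 - (1 - b / Γ) ^ m) ^ (Finset.univ.filter (fun x => σ x = false)).card :=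
        (iidProb_exists_le hq _ _).trans (Finset.sum_le_sum fun σ _ => key σ)
    _ = Γ ^ m * ∑ σ : Fin n → Bool, ∏ x, (if σ x = false then 1 - (1 - b / Γ) ^ m else 1) := by
        rw [Finset.mul_sum]
        refine Finset.sum_congr rfl fun σ _ => ?_
        rw [Finset.prod_ite, Finset.prod_const, Finset.prod_const_one, mul_one]
    _ = _ := by
        rw [← Fintype.piFinset_univ, Finset.sum_prod_piFinset Finset.univ
          (fun (_ : Fin n) (b' : Bool) => if b' = false then 1 - (1 - b / Γ) ^ m else 1)]
        simp only [Fintype.sum_bool, Finset.prod_const, Finset.card_univ, Fintype.card_fin]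
        simp only [Bool.true_eq_false, if_false, if_true, hbd]
        ring

/-- The first moment bound is exponentially small when its limiting base is below `1`. -/
lemma tendsto_randomSatProb_of_lt_one {k : ℕ} (hk : 1 ≤ k) {c : ℝ} (hc : 0 ≤ c)
    (h : (1 - 1 / 2 ^ k : ℝ) ^ c * (2 - Real.exp (-(k / (2 ^ k - 1))) ^ c) < 1) :
    Tendsto (fun n : ℕ => randomSatProb k n ⌊c * n⌋₊) atTop (𝓝 0) := by
  set Γ : ℝ := 1 - 1 / 2 ^ k with hΓ
  set A : ℝ := k / (2 ^ k - 1) with hA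
  have h2 : (2 : ℝ) ≤ 2 ^ k := by
    calc (2 : ℝ) = 2 ^ 1 := by norm_num
      _ ≤ 2 ^ k := pow_le_pow_right₀ (by norm_num) hk
  have hΓ0 : 0 < Γ := by
    have : (1 : ℝ) / 2 ^ k ≤ 1 / 2 := one_div_le_one_div_of_le (by norm_num) h2
    linarith
  have hΓ1 : Γ ≤ 1 := by
    have : (0 : ℝ) ≤ 1 / 2 ^ k := by positivity
    linarith
  have hA0 : 0 ≤ A := div_nonneg (by positivity) (by linarith)
  have hlim : Tendsto (fun n : ℕ => Γ ^ c * (2 - ((1 + (-A) / n) ^ n) ^ c)) atTop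
      (𝓝 (Γ ^ c * (2 - Real.exp (-A) ^ c))) :=
    ((((Real.tendsto_one_add_div_pow_exp (-A)).rpow_const (Or.inl (Real.exp_pos _).ne')).const_sub
      2).const_mul _)
  obtain ⟨ρ, hρ, hρ1⟩ := exists_between h
  have hρ0 : 0 ≤ ρ := by
    refine le_trans (mul_nonneg (by positivity) ?_) hρ.le
    have : Real.exp (-A) ^ c ≤ 1 :=
      Real.rpow_le_one (Real.exp_pos _).le (Real.exp_le_one_iff.2 (by linarith)) hc
    linarith
  have hbound : ∀ᶠ n : ℕ in atTop, randomSatProb k n ⌊c * n⌋₊ ≤ Γ⁻¹ * ρ ^ n := by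
    filter_upwards [hlim.eventually (gt_mem_nhds hρ), eventually_ge_atTop k,
      eventually_ge_atTop (⌈A⌉₊ + 1)] with n hn hkn hAn
    have hn0 : (0 : ℝ) < n := by exact_mod_cast (show 0 < n by omega)
    have hAn' : A / n < 1 := by
      rw [div_lt_one hn0]
      exact (Nat.le_ceil A).trans_lt (by exact_mod_cast (by omega))
    have hm : (⌊c * n⌋₊ : ℝ) ≤ c * n := Nat.floor_le (by positivity)
    have hm' : c * n - 1 ≤ (⌊c * n⌋₊ : ℝ) := (Nat.sub_one_lt_floor _).le
    have hx0 : 0 < 1 + -A / n := by rw [neg_div]; linarith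
    have hx1 : 1 + -A / n ≤ 1 := by
      have : 0 ≤ A / n := by positivity
      rw [neg_div]; linarith
    refine (randomSatProb_le hk hkn _).trans ?_
    have e1 : Γ ^ ⌊c * n⌋₊ ≤ Γ⁻¹ * (Γ ^ c) ^ n := by
      rw [← Real.rpow_natCast, ← Real.rpow_natCast, ← Real.rpow_mul hΓ0.le, ← Real.rpow_neg_one,
        ← Real.rpow_add hΓ0]
      exact Real.rpow_le_rpow_of_exponent_ge hΓ0 hΓ1 (by linarith)
    have e2 : ((1 + -A / n) ^ n) ^ c ≤ (1 - A / n) ^ ⌊c * n⌋₊ := by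
      rw [show 1 - A / n = 1 + -A / n by ring, ← Real.rpow_natCast, ← Real.rpow_natCast,
        ← Real.rpow_mul hx0.le]
      exact Real.rpow_le_rpow_of_exponent_ge hx0 hx1 (by linarith)
    have e3 : (1 - A / n) ^ ⌊c * n⌋₊ ≤ 1 := by
      rw [show 1 - A / n = 1 + -A / n by ring]
      exact pow_le_one₀ hx0.le hx1
    calc _ ≤ (Γ⁻¹ * (Γ ^ c) ^ n) * (2 - ((1 + -A / n) ^ n) ^ c) ^ n := by
          refine mul_le_mul e1 (pow_le_pow_left₀ (by linarith) (by linarith) n)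
            (pow_nonneg (by linarith) n) (by positivity)
      _ = Γ⁻¹ * (Γ ^ c * (2 - ((1 + -A / n) ^ n) ^ c)) ^ n := by rw [mul_pow]; ring
      _ ≤ Γ⁻¹ * ρ ^ n := by
          refine mul_le_mul_of_nonneg_left (pow_le_pow_left₀ (mul_nonneg (by positivity) ?_)
            hn.le n) (by positivity)
          linarith
  refine tendsto_of_tendsto_of_tendsto_of_le_of_le' tendsto_const_nhds ?_
    (Eventually.of_forall fun n => randomSatProb_nonneg _ _ _) hbound
  simpa using (tendsto_pow_atTop_nhds_zero_of_lt_one hρ0 hρ1).const_mul Γ⁻¹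

/-! ### Sets of literals generated in the implication digraph -/

/-- The complementary literal. -/
def Literal.neg {n : ℕ} (l : Literal n) : Literal n := (l.1, !l.2)

/-- The arcs of the implication digraph of a 2-SAT formula: `u ⟶ w` when `¬u ∨ w` is a clause. -/
def Implies {n m : ℕ} (F : Formula 2 n m) (u w : Literal n) : Prop :=
  ∃ i, (F i).1 = {u.neg, w}

/-- A set of literals is consistent when its literals are on distinct variables. -/
def Consistent {n : ℕ} (T : Finset (Literal n)) : Prop :=
  Set.InjOn Prod.fst (T : Set (Literal n))

section TwoSat

variable {n m : ℕ}

@[simp] lemma Literal.neg_fst (l : Literal n) : l.neg.1 = l.1 := rfl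

@[simp] lemma Literal.neg_neg (l : Literal n) : l.neg.neg = l := by simp [Literal.neg]

lemma Literal.neg_ne (l : Literal n) : l.neg ≠ l := fun h => by
  have := congrArg Prod.snd h
  simp [Literal.neg] at this

lemma Literal.neg_injective : Function.Injective (Literal.neg (n := n)) := fun a b h => by
  rw [← a.neg_neg, h, b.neg_neg]

lemma Literal.eq_or_eq_neg {a b : Literal n} (h : a.1 = b.1) : a = b ∨ a = b.neg := by
  obtain ⟨x, s⟩ := a
  obtain ⟨y, t⟩ := b
  simp only at h
  subst h
  cases s <;> cases t <;> simp [Literal.neg]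

lemma Clause.fst_ne_of_eq_pair {c : Clause 2 n} {a b : Literal n} (h : c.1 = {a, b}) :
    a.1 ≠ b.1 := fun hab => by
  have h1 := c.2.2 a (by rw [h]; simp) b (by rw [h]; simp) hab
  have h2 := c.2.1
  rw [h, h1] at h2
  simp at h2

/-- The clause `a ∨ b`. -/
def Clause.pair (a b : Literal n) (h : a.1 ≠ b.1) : Clause 2 n :=
  ⟨{a, b}, Finset.card_pair fun e => h (by rw [e]), by
    intro x hx y hy hxy
    simp only [Finset.mem_insert, Finset.mem_singleton] at hx hy
    rcases hx with rfl | rfl <;> rcases hy with rfl | rfl <;> first | rfl | exact absurd hxy h |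
      exact absurd hxy.symm h⟩

lemma Implies.contrapose {F : Formula 2 n m} {u w : Literal n} (h : Implies F u w) :
    Implies F w.neg u.neg := by
  obtain ⟨i, hi⟩ := h
  exact ⟨i, by rw [hi, Literal.neg_neg, Finset.pair_comm]⟩

lemma reflTransGen_contrapose {F : Formula 2 n m} {u w : Literal n}
    (h : Relation.ReflTransGen (Implies F) u w) :
    Relation.ReflTransGen (Implies F) w.neg u.neg := by
  induction h with
  | refl => exact .refl
  | tail _ h ih => exact ih.head h.contrapose

/-- The clauses `¬t ∨ w` with `t ∈ T`, which give an arc from `T` to `w`. -/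
def arcClauses (T : Finset (Literal n)) (w : Literal n) : Finset (Clause 2 n) :=
  Finset.univ.filter fun c => ∃ t ∈ T, c.1 = {t.neg, w}

/-- The clauses that give an arc from `T` to a literal on a variable that does not occur in `T`. -/
def exitClauses (T : Finset (Literal n)) : Finset (Clause 2 n) :=
  Finset.univ.filter fun c => ∃ t ∈ T, ∃ w : Literal n, w.1 ∉ T.image Prod.fst ∧ c.1 = {t.neg, w}

/-- The clauses that are violated when all literals of `Q` are true. -/
def killingClauses (Q : Finset (Literal n)) : Finset (Clause 2 n) :=
  Finset.univ.filter fun c => ∀ l ∈ c.1, l.neg ∈ Q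

lemma card_arcClauses_le (T : Finset (Literal n)) (w : Literal n) :
    (arcClauses T w).card ≤ T.card := by
  classical
  have : arcClauses T w ⊆
      T.biUnion fun t => Finset.univ.filter fun c : Clause 2 n => c.1 = {t.neg, w} := by
    intro c hc
    obtain ⟨t, ht, h⟩ := (Finset.mem_filter.1 hc).2
    exact Finset.mem_biUnion.2 ⟨t, ht, Finset.mem_filter.2 ⟨Finset.mem_univ _, h⟩⟩
  refine (Finset.card_le_card this).trans ((Finset.card_biUnion_le_card_mul _ _ 1 fun t _ => ?_).trans
    (mul_one _).le)
  refine Finset.card_le_one.2 fun c hc d hd => Subtype.ext ?_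
  rw [(Finset.mem_filter.1 hc).2, (Finset.mem_filter.1 hd).2]

lemma pairwiseDisjoint_arcClauses {T : Finset (Literal n)} (hT : Consistent T) :
    (T : Set (Literal n)).PairwiseDisjoint (arcClauses T) := by
  intro w hw w' _ hne
  refine Finset.disjoint_left.2 fun c hc hc' => ?_
  obtain ⟨t, ht, h⟩ := (Finset.mem_filter.1 hc).2
  obtain ⟨t', ht', h'⟩ := (Finset.mem_filter.1 hc').2
  have h1 : w ∈ c.1 := by rw [h]; simp
  rw [h', Finset.mem_insert, Finset.mem_singleton] at h1
  rcases h1 with h1 | h1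
  · have := hT hw ht' (by rw [h1]; rfl)
    exact t'.neg_ne (h1 ▸ this)
  · exact hne h1

lemma le_card_exitClauses {T : Finset (Literal n)} (hT : Consistent T) :
    T.card * ((n - T.card) * 2) ≤ (exitClauses T).card := by
  classical
  have h1 : (T ×ˢ ((T.image Prod.fst)ᶜ ×ˢ (Finset.univ : Finset Bool))).card
      = T.card * ((n - T.card) * 2) := by
    rw [Finset.card_product, Finset.card_product, Finset.card_compl,
      Finset.card_image_of_injOn hT]
    simp
  rw [← h1, ← Finset.card_image_of_injective (exitClauses T) Subtype.val_injective]
  refine Finset.card_le_card_of_injOn (fun p => {p.1.neg, p.2}) ?_ ?_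
  · rintro ⟨t, w⟩ h
    simp only [Finset.coe_product, Set.mem_prod, Finset.mem_coe, Finset.mem_compl] at h
    have hne : t.neg.1 ≠ w.1 := fun e => h.2.1 (Finset.mem_image.2 ⟨t, h.1, e⟩)
    exact Finset.mem_coe.2 (Finset.mem_image.2 ⟨Clause.pair t.neg w hne,
      Finset.mem_filter.2 ⟨Finset.mem_univ _, t, h.1, w, h.2.1, rfl⟩, rfl⟩)
  · rintro ⟨t, w⟩ h ⟨t', w'⟩ h' e
    simp only [Finset.coe_product, Set.mem_prod, Finset.mem_coe, Finset.mem_compl] at h h' e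
    have e1 : t.neg ∈ ({t'.neg, w'} : Finset (Literal n)) := by rw [← e]; simp
    have e2 : w ∈ ({t'.neg, w'} : Finset (Literal n)) := by rw [← e]; simp
    rw [Finset.mem_insert, Finset.mem_singleton] at e1 e2
    have e3 : t.neg = t'.neg := e1.resolve_right fun e1 =>
      h'.2.1 (Finset.mem_image.2 ⟨t, h.1, by rw [← e1]; rfl⟩)
    have e4 : w = w' := e2.resolve_left fun e2 =>
      h.2.1 (Finset.mem_image.2 ⟨t', h'.1, by rw [e2]; rfl⟩)
    rw [Literal.neg_injective e3, e4]

lemma le_card_killingClauses {Q : Finset (Literal n)} (hQ : Consistent Q) :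
    Q.card.choose 2 ≤ (killingClauses Q).card := by
  classical
  rw [← Finset.card_powersetCard,
    ← Finset.card_image_of_injective (killingClauses Q) Subtype.val_injective]
  refine Finset.card_le_card_of_injOn (fun P => P.image Literal.neg) ?_ ?_
  · intro P hP
    obtain ⟨h1, h2⟩ := Finset.mem_powersetCard.1 (Finset.mem_coe.1 hP)
    obtain ⟨a, b, hab, rfl⟩ := Finset.card_eq_two.1 h2
    have ha := h1 (Finset.mem_insert_self a _)
    have hb := h1 (Finset.mem_insert_of_mem (Finset.mem_singleton_self b))
    have hne : a.neg.1 ≠ b.neg.1 := fun e => hab (hQ ha hb e)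
    refine Finset.mem_coe.2 (Finset.mem_image.2 ⟨Clause.pair a.neg b.neg hne,
      Finset.mem_filter.2 ⟨Finset.mem_univ _, ?_⟩, ?_⟩)
    · intro l hl
      simp only [Clause.pair, Finset.mem_insert, Finset.mem_singleton] at hl
      rcases hl with rfl | rfl <;> simpa
    · simp [Clause.pair, Finset.image_insert]
  · intro P _ P' _ e
    exact Finset.image_injective Literal.neg_injective e

/-- The number of 2-clauses. -/
lemma card_clause_two (n : ℕ) : (Fintype.card (Clause 2 n) : ℝ) = 2 * n * (n - 1) := by
  rw [Clause.card_eq]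
  push_cast
  rw [Nat.cast_choose_two]
  ring

/-- The literals `U` together with the positive literals (the roots) of those variables of `W` that
do not occur in `U`.  As a generated set is determined by `W` and its other literals `U`, a union
bound over generated sets only has to count the sets `U`. -/
def withRoots (W : Finset (Fin n)) (U : Finset (Literal n)) : Finset (Literal n) :=
  U ∪ (W \ U.image Prod.fst).image fun v => (v, true)

/-- In every formula, the positive literals on a set `W` of variables generate a consistent set
`T` of literals which covers `W`, has no exits, and in which every literal that is not a root has an
arc from `T`.  It is a maximal consistent set of literals that are reached from roots. -/
lemma exists_generated (F : Formula 2 n m) (W : Finset (Fin n)) :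
    ∃ U : Finset (Literal n), Consistent (withRoots W U) ∧ W.card ≤ (withRoots W U).card ∧
      (∀ i, F i ∉ exitClauses (withRoots W U)) ∧
      (∀ w ∈ U, ∃ i, F i ∈ arcClauses (withRoots W U) w) ∧
      ∀ w ∈ withRoots W U, ∃ x ∈ W, Relation.ReflTransGen (Implies F) (x, true) w := by
  classical
  set P : Finset (Literal n) → Prop := fun T => Consistent T ∧
    (∀ w ∈ T, (w.1 ∈ W ∧ w.2 = true) ∨ ∃ i, F i ∈ arcClauses T w) ∧
    ∀ w ∈ T, ∃ x ∈ W, Relation.ReflTransGen (Implies F) (x, true) w with hP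
  obtain ⟨T, hT, hmax⟩ := Finset.exists_max_image
    ((Finset.univ : Finset (Finset (Literal n))).filter P) Finset.card
    ⟨∅, by simp [hP, Consistent]⟩
  obtain ⟨hT1, hT2, hT3⟩ := (Finset.mem_filter.1 hT).2
  have hext : ∀ w : Literal n, w.1 ∉ T.image Prod.fst → P (insert w T) → False := by
    intro w hw hPw
    have := hmax _ (Finset.mem_filter.2 ⟨Finset.mem_univ _, hPw⟩)
    rw [Finset.card_insert_of_notMem fun h => hw (Finset.mem_image_of_mem _ h)] at this
    omega
  have hcons : ∀ w : Literal n, w.1 ∉ T.image Prod.fst → Consistent (insert w T) := by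
    intro w hw
    unfold Consistent
    rw [Finset.coe_insert, Set.injOn_insert fun h => hw (Finset.mem_image_of_mem _ h)]
    exact ⟨hT1, by simpa using hw⟩
  have harc : ∀ w v : Literal n, arcClauses T v ⊆ arcClauses (insert w T) v := by
    intro w v c hc
    obtain ⟨t, ht, h⟩ := (Finset.mem_filter.1 hc).2
    exact Finset.mem_filter.2 ⟨Finset.mem_univ _, t, Finset.mem_insert_of_mem ht, h⟩
  have hold : ∀ w v : Literal n, v ∈ T →
      (v.1 ∈ W ∧ v.2 = true) ∨ ∃ i, F i ∈ arcClauses (insert w T) v := by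
    intro w v hv
    rcases hT2 v hv with h | ⟨i, hi⟩
    · exact Or.inl h
    · exact Or.inr ⟨i, harc w v hi⟩
  -- by maximality, a missing root or the end of an exit cannot be added
  have hW : ∀ v ∈ W, v ∈ T.image Prod.fst := by
    intro v hv
    by_contra hvT
    refine hext (v, true) hvT ⟨hcons _ hvT, ?_, ?_⟩
    · intro u hu
      rcases Finset.mem_insert.1 hu with rfl | hu
      · exact Or.inl ⟨hv, rfl⟩
      · exact hold _ u hu
    · intro u hu
      rcases Finset.mem_insert.1 hu with rfl | hu
      · exact ⟨v, hv, .refl⟩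
      · exact hT3 u hu
  have hexit : ∀ i, F i ∉ exitClauses T := by
    intro i hi
    obtain ⟨t, ht, w, hw, h⟩ := (Finset.mem_filter.1 hi).2
    refine hext w hw ⟨hcons _ hw, ?_, ?_⟩
    · intro u hu
      rcases Finset.mem_insert.1 hu with rfl | hu
      · exact Or.inr ⟨i, Finset.mem_filter.2 ⟨Finset.mem_univ _, t, Finset.mem_insert_of_mem ht, h⟩⟩
      · exact hold _ u hu
    · intro u hu
      rcases Finset.mem_insert.1 hu with rfl | hu
      · obtain ⟨x, hx, hr⟩ := hT3 t ht
        exact ⟨x, hx, hr.tail ⟨i, h⟩⟩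
      · exact hT3 u hu
  set U := T.filter fun w => ¬ (w.1 ∈ W ∧ w.2 = true) with hU
  -- a variable of `W` occurs in `T` either with its root or in `U`, and not in both
  have hTU : withRoots W U = T := by
    ext l
    simp only [withRoots, Finset.mem_union, Finset.mem_image, Finset.mem_sdiff]
    constructor
    · rintro (h | ⟨v, ⟨hv, hvU⟩, rfl⟩)
      · exact (Finset.mem_filter.1 h).1
      · obtain ⟨l, hl, rfl⟩ := Finset.mem_image.1 (hW v hv)
        have : l ∉ U := fun h => hvU ⟨l, h, rfl⟩
        rw [hU, Finset.mem_filter, not_and, not_not] at this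
        have h2 := (this hl).2
        rwa [← h2]
    · intro hl
      by_cases h : l.1 ∈ W ∧ l.2 = true
      · refine Or.inr ⟨l.1, ⟨h.1, ?_⟩, by rw [← h.2]⟩
        rintro ⟨a, ha, hal⟩
        obtain ⟨haT, ha'⟩ := Finset.mem_filter.1 ha
        exact ha' (hT1 haT hl hal ▸ h)
      · exact Or.inl (Finset.mem_filter.2 ⟨hl, h⟩)
  refine ⟨U, ?_⟩
  rw [hTU]
  refine ⟨hT1, ?_, hexit, fun w hw => ?_, hT3⟩
  · rw [← Finset.card_image_of_injOn hT1]
    exact Finset.card_le_card hW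
  · obtain ⟨hwT, hw'⟩ := Finset.mem_filter.1 hw
    exact (hT2 w hwT).resolve_left hw'

/-- The probability that `T` has no exits while every literal of `U ⊆ T` has an arc from `T`. -/
lemma iidProb_generated_le {T U : Finset (Literal n)} (hT : Consistent T) (hU : U ⊆ T)
    (hn : 2 ≤ n) {Γ : ℝ}
    (hΓ : Γ = 1 - 2 * T.card * (n - T.card) / (2 * n * (n - 1)))
    (hΓT : T.card / (2 * n * (n - 1)) ≤ Γ) (hΓ0 : 0 < Γ) (m : ℕ) :
    iidProb (unifClause 2 n) m (fun F => (∀ i, F i ∉ exitClauses T) ∧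
      ∀ w ∈ U, ∃ i, F i ∈ arcClauses T w) ≤
      Γ ^ m * (m * (T.card / (2 * n * (n - 1)) / Γ)) ^ U.card := by
  classical
  have hq := unifClause_nonneg 2 n
  have htn : T.card ≤ n := by
    rw [← Finset.card_image_of_injOn hT]
    exact (Finset.card_le_univ _).trans (by simp)
  -- The bound for the arcs grows when the weight `Γ` of the admissible clauses shrinks, so that exactly
  -- as many exit clauses are forbidden as the lower bound on their number says.
  obtain ⟨X, hX, hXc⟩ := Finset.exists_subset_card_eq (le_card_exitClauses hT)
  have hN : (0 : ℝ) < 2 * n * (n - 1) := by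
    have : (2 : ℝ) ≤ n := by exact_mod_cast hn
    nlinarith
  have h1 : iidProb (unifClause 2 n) m (fun F => (∀ i, F i ∉ exitClauses T) ∧
      ∀ w ∈ U, ∃ i, F i ∈ arcClauses T w) ≤
      iidProb (unifClause 2 n) m (fun F => (∀ i, F i ∈ Xᶜ) ∧
      ∀ w ∈ U, ∃ i, F i ∈ arcClauses T w) := by
    refine iidProb_mono hq fun F hF => ⟨fun i => ?_, hF.2⟩
    exact Finset.mem_compl.2 fun h => hF.1 i (hX h)
  refine h1.trans ?_
  rw [iidProb_forall_mem_and]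
  refine (iidProb_forall_hit_le' (fun c => by split_ifs <;> simp [hq c]) hΓ0 ?_ _ _
      ((pairwiseDisjoint_arcClauses hT).subset (by simpa using hU)) _ hΓT (fun x _ => ?_) m).trans ?_
  · rw [Finset.sum_ite_mem, Finset.univ_inter]
    have h2 := Finset.sum_add_sum_compl X (unifClause 2 n)
    rw [sum_unifClause hn, sum_unifClause_finset X, hXc, card_clause_two] at h2
    push_cast [Nat.cast_sub htn] at h2
    have h3 : ((T.card : ℝ) * ((n - T.card) * 2)) / (2 * n * (n - 1)) =
        2 * T.card * (n - T.card) / (2 * n * (n - 1)) := by ring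
    rw [hΓ]
    linarith
  · calc _ ≤ ∑ c ∈ arcClauses T x, unifClause 2 n c :=
            Finset.sum_le_sum fun c _ => by split_ifs <;> simp [hq c]
        _ ≤ _ := by
            rw [sum_unifClause_finset, card_clause_two]
            refine div_le_div_of_nonneg_right ?_ hN.le
            exact_mod_cast card_arcClauses_le T x
  · have hb1 : (T.card / (2 * n * (n - 1)) / Γ : ℝ) ≤ 1 := (div_le_one hΓ0).2 hΓT
    have hb0 : (0 : ℝ) ≤ T.card / (2 * n * (n - 1)) / Γ := by positivity
    refine mul_le_mul_of_nonneg_left (pow_le_pow_left₀ ?_ (one_sub_one_sub_pow_le hb1 m) _)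
      (by positivity)
    exact sub_nonneg.2 (pow_le_one₀ (by linarith) (by linarith))

end TwoSat

/-! ### Generated sets are large -/

/-- The numerical heart of the first moment bound: at density `3 / 2` the expected number of
generated sets of size `t ≤ n / 50` is exponentially small in `t`, since `(3 / 2) * exp (-1 / 2)` is
less than `1`. -/
lemma choose_mul_generated_bound_le {n t u m : ℕ} (hn : 1000 ≤ n) (ht : 50 * t < n) (ht1 : 1 ≤ t)
    (hu : u ≤ t) (hm : m = ⌊(3 / 2 : ℝ) * n⌋₊) {Γ : ℝ}
    (hΓ : Γ = 1 - 2 * t * (n - t) / (2 * n * (n - 1))) :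
    (t / (2 * n * (n - 1)) ≤ Γ ∧ 0 < Γ) ∧
    ((2 * n).choose u : ℝ) * (Γ ^ m * (m * (t / (2 * n * (n - 1)) / Γ)) ^ u) ≤ 0.98 ^ t := by
  have hn' : (1000 : ℝ) ≤ n := by exact_mod_cast hn
  have ht' : 50 * (t : ℝ) < n := by exact_mod_cast ht
  have ht1' : (1 : ℝ) ≤ t := by exact_mod_cast ht1
  have hN : (0 : ℝ) < 2 * n * (n - 1) := by nlinarith
  set N : ℝ := 2 * n * (n - 1) with hNdef
  have hNΓ : N * Γ = 2 * n * (n - 1) - 2 * t * (n - t) := by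
    rw [hΓ]; field_simp; rw [hNdef]; ring
  have hNΓ' : 0.97 * (2 * n * n) ≤ N * Γ := by rw [hNΓ]; nlinarith
  have hΓ0 : 0 < Γ := by
    by_contra h
    have : N * Γ ≤ 0 := mul_nonpos_of_nonneg_of_nonpos hN.le (not_lt.1 h)
    nlinarith
  refine ⟨⟨?_, hΓ0⟩, ?_⟩
  · rw [div_le_iff₀ hN]; nlinarith
  have hm1 : (m : ℝ) ≤ 3 / 2 * n := hm ▸ Nat.floor_le (by positivity)
  have hm2 : 3 / 2 * n - 1 ≤ (m : ℝ) := hm ▸ (Nat.sub_one_lt_floor _).le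
  have e1 : ((2 * n).choose u : ℝ) ≤ (2 * n) ^ u / u.factorial := by
    have := Nat.choose_le_pow_div (α := ℝ) u (2 * n)
    push_cast at this
    exact this
  -- `1.55 > 1.5 / 0.97` and `1.46 < 1.5 * 0.98`, as `t ≤ n / 50`
  have e2 : (2 * n) * (m * (t / N / Γ)) ≤ 1.55 * t := by
    rw [div_div, ← mul_div_assoc, ← mul_div_assoc, div_le_iff₀ (by positivity)]
    have : (m : ℝ) * t ≤ 3 / 2 * n * t := mul_le_mul_of_nonneg_right hm1 (by linarith)
    nlinarith
  have e3 : Γ ^ m ≤ Real.exp (-(1.46 * t)) := by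
    have h1 : Γ ≤ Real.exp (-(2 * t * (n - t) / N)) := by
      have := Real.add_one_le_exp (-(2 * t * (n - t) / N))
      rw [hΓ]; linarith
    refine (pow_le_pow_left₀ hΓ0.le h1 m).trans ?_
    rw [← Real.exp_nat_mul]
    refine Real.exp_le_exp.2 ?_
    have h2 : 0.98 * t / n ≤ 2 * t * (n - t) / N := by
      rw [div_le_div_iff₀ (by linarith) hN]
      have := mul_le_mul_of_nonneg_left (show 0.98 * ((n : ℝ) - 1) ≤ n - t by linarith)
        (show (0 : ℝ) ≤ 2 * t * n by positivity)
      rw [hNdef]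
      linarith
    have h3 : 1.46 * (t : ℝ) ≤ m * (0.98 * t / n) := by
      rw [← mul_div_assoc, le_div_iff₀ (by linarith)]
      nlinarith
    have h4 := mul_le_mul_of_nonneg_left h2 (Nat.cast_nonneg (α := ℝ) m)
    linarith
  have e4 : Real.exp (-0.46) * 1.55 ≤ 0.98 := by
    have h1 := Real.sum_le_exp_of_nonneg (x := 0.46) (by norm_num) 5
    have h2 : (1.583 : ℝ) ≤ Real.exp 0.46 := by
      refine le_trans ?_ h1
      norm_num [Finset.sum_range_succ, Nat.factorial]
    rw [Real.exp_neg, inv_mul_le_iff₀ (Real.exp_pos _)]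
    linarith
  have hb0 : 0 ≤ (m : ℝ) * (t / N / Γ) := by positivity
  calc ((2 * n).choose u : ℝ) * (Γ ^ m * (m * (t / N / Γ)) ^ u)
      ≤ ((2 * n) ^ u / u.factorial) * (Real.exp (-(1.46 * t)) * (m * (t / N / Γ)) ^ u) := by
        gcongr
    _ = ((2 * n) * (m * (t / N / Γ))) ^ u / u.factorial * Real.exp (-(1.46 * t)) := by
        rw [mul_pow]; ring
    _ ≤ (1.55 * t) ^ u / u.factorial * Real.exp (-(1.46 * t)) := by gcongr
    _ = 1.55 ^ u * (t ^ u / u.factorial) * Real.exp (-(1.46 * t)) := by rw [mul_pow]; ring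
    -- the two uses of `u ≤ t`: `1.55 ^ u ≤ 1.55 ^ t`, while `t ^ u / u!` is a term of `exp t`
    _ ≤ 1.55 ^ t * Real.exp t * Real.exp (-(1.46 * t)) := by
        gcongr
        · norm_num
        · exact Real.pow_div_factorial_le_exp _ (by linarith) u
    _ = (Real.exp (-0.46) * 1.55) ^ t := by
        rw [mul_pow, ← Real.exp_nat_mul, mul_assoc, ← Real.exp_add, mul_comm]
        congr 2; ring
    _ ≤ 0.98 ^ t := pow_le_pow_left₀ (by positivity) e4 t

/-- Some variable of `W`, when set to true, forces a large consistent set `Q` of literals. -/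
def Fruitful {n m : ℕ} (F : Formula 2 n m) (W : Finset (Fin n)) : Prop :=
  ∃ x ∈ W, ∃ Q : Finset (Literal n), Consistent Q ∧
    (∀ w ∈ Q, Relation.ReflTransGen (Implies F) (x, true) w) ∧ n ≤ 50 * W.card * Q.card

/-- The set generated by the roots on `W` is small if `W` is not fruitful: it is covered by the
consequences of the single roots. -/
lemma exists_generated_of_not_fruitful {n m : ℕ} {F : Formula 2 n m} {W : Finset (Fin n)}
    (hW : W.Nonempty) (h : ¬ Fruitful F W) :
    ∃ U : Finset (Literal n), (Consistent (withRoots W U) ∧ W.card ≤ (withRoots W U).card ∧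
      50 * (withRoots W U).card < n) ∧ (∀ i, F i ∉ exitClauses (withRoots W U)) ∧
      ∀ w ∈ U, ∃ i, F i ∈ arcClauses (withRoots W U) w := by
  classical
  obtain ⟨U, h1, h2, h3, h4, h5⟩ := exists_generated F W
  refine ⟨U, ⟨h1, h2, ?_⟩, h3, h4⟩
  by_contra hlt
  set T := withRoots W U with hT
  set Q : Fin n → Finset (Literal n) := fun x =>
    T.filter fun w => Relation.ReflTransGen (Implies F) (x, true) w with hQ
  have hcov : T ⊆ W.biUnion Q := fun w hw => by
    obtain ⟨x, hx, hr⟩ := h5 w hw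
    exact Finset.mem_biUnion.2 ⟨x, hx, Finset.mem_filter.2 ⟨hw, hr⟩⟩
  have hex : ∃ x ∈ W, T.card ≤ W.card * (Q x).card := by
    by_contra hno
    push Not at hno
    have hc := (Finset.card_le_card hcov).trans Finset.card_biUnion_le
    have h6 : W.card * ∑ x ∈ W, (Q x).card < W.card * T.card := by
      rw [Finset.mul_sum, ← smul_eq_mul W.card T.card, ← Finset.sum_const]
      exact Finset.sum_lt_sum_of_nonempty hW hno
    exact absurd (Nat.mul_le_mul_left W.card hc) (not_le.2 h6)
  obtain ⟨x, hx, hx'⟩ := hex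
  refine h ⟨x, hx, Q x, h1.mono (Finset.coe_subset.2 (Finset.filter_subset _ _)), fun w hw => (Finset.mem_filter.1 hw).2, ?_⟩
  nlinarith

/-- A set of variables is fruitful up to a probability that is exponentially small in its size, by
the union bound over the generated sets, sorted by the sizes of `U` and of `withRoots W U`. -/
lemma iidProb_not_fruitful_le {n : ℕ} (hn : 1000 ≤ n) {W : Finset (Fin n)} (hW : W.Nonempty) :
    iidProb (unifClause 2 n) ⌊(3 / 2 : ℝ) * n⌋₊ (fun F => ¬ Fruitful F W) ≤
      (n + 1) ^ 2 * 0.98 ^ W.card := by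
  classical
  have hq := unifClause_nonneg 2 n
  set m := ⌊(3 / 2 : ℝ) * n⌋₊ with hm
  set 𝒰 := (Finset.univ : Finset (Finset (Literal n))).filter fun U =>
    Consistent (withRoots W U) ∧ W.card ≤ (withRoots W U).card ∧
      50 * (withRoots W U).card < n with h𝒰
  set Γ : ℕ → ℝ := fun t => 1 - 2 * t * (n - t) / (2 * n * (n - 1)) with hΓ
  set B : ℕ × ℕ → ℝ := fun p =>
    Γ p.2 ^ m * (m * (p.2 / (2 * n * (n - 1)) / Γ p.2)) ^ p.1 with hB
  set f : Finset (Literal n) → ℕ × ℕ := fun U => (U.card, (withRoots W U).card) with hf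
  have hpos := hW.card_pos
  have hmem : ∀ U ∈ 𝒰, f U ∈ Finset.range (n + 1) ×ˢ Finset.range (n + 1) := by
    intro U hU
    obtain ⟨-, h1, h2, h3⟩ := Finset.mem_filter.1 hU
    have : U.card ≤ (withRoots W U).card := Finset.card_le_card Finset.subset_union_left
    simp only [hf, Finset.mem_product, Finset.mem_range]
    omega
  calc iidProb (unifClause 2 n) m (fun F => ¬ Fruitful F W)
      ≤ iidProb (unifClause 2 n) m (fun F => ∃ U ∈ 𝒰,
          (∀ i, F i ∉ exitClauses (withRoots W U)) ∧
          ∀ w ∈ U, ∃ i, F i ∈ arcClauses (withRoots W U) w) :=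
        iidProb_mono hq fun F hF => by
          obtain ⟨U, h1, h2⟩ := exists_generated_of_not_fruitful hW hF
          exact ⟨U, Finset.mem_filter.2 ⟨Finset.mem_univ _, h1⟩, h2⟩
    _ ≤ ∑ U ∈ 𝒰, B (f U) := by
        refine (iidProb_exists_le hq _ _).trans (Finset.sum_le_sum fun U hU => ?_)
        obtain ⟨-, h1, h2, h3⟩ := Finset.mem_filter.1 hU
        obtain ⟨⟨h4, h5⟩, -⟩ := choose_mul_generated_bound_le hn h3 (hpos.trans_le h2)
          (Nat.zero_le _) hm rfl
        exact iidProb_generated_le h1 Finset.subset_union_left (by omega) rfl h4 h5 m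
    _ = ∑ p ∈ Finset.range (n + 1) ×ˢ Finset.range (n + 1), ∑ U ∈ 𝒰 with f U = p, B (f U) :=
        (Finset.sum_fiberwise_of_maps_to hmem _).symm
    _ ≤ ∑ _p ∈ Finset.range (n + 1) ×ˢ Finset.range (n + 1), (0.98 : ℝ) ^ W.card := by
        refine Finset.sum_le_sum fun p _ => ?_
        rcases (𝒰.filter fun U => f U = p).eq_empty_or_nonempty with he | ⟨U, hU⟩
        · rw [he, Finset.sum_empty]; positivity
        · obtain ⟨hU𝒰, rfl⟩ := Finset.mem_filter.1 hU
          have ⟨_, h2, h3⟩ := (Finset.mem_filter.1 hU𝒰).2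
          obtain ⟨⟨h4, h5⟩, h6⟩ := choose_mul_generated_bound_le hn h3 (hpos.trans_le h2)
            (Finset.card_le_card Finset.subset_union_left : U.card ≤ (withRoots W U).card) hm rfl
          have hB0 : 0 ≤ B (f U) := by
            have hn' : (1000 : ℝ) ≤ n := by exact_mod_cast hn
            have : (0 : ℝ) ≤ 2 * n * (n - 1) := by nlinarith
            have h7 : 0 ≤ Γ (withRoots W U).card := h5.le
            simp only [hB, hf]
            positivity
          calc ∑ V ∈ 𝒰 with f V = f U, B (f V) = ∑ V ∈ 𝒰 with f V = f U, B (f U) :=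
                Finset.sum_congr rfl fun V hV => by rw [(Finset.mem_filter.1 hV).2]
            _ = (𝒰.filter fun V => f V = f U).card * B (f U) := by
                rw [Finset.sum_const, nsmul_eq_mul]
            _ ≤ ((2 * n).choose U.card : ℝ) * B (f U) := by
                refine mul_le_mul_of_nonneg_right ?_ hB0
                have : (Finset.powersetCard U.card (Finset.univ : Finset (Literal n))).card
                    = (2 * n).choose U.card := by
                  rw [Finset.card_powersetCard, Finset.card_univ]
                  simp [mul_comm]
                rw [← this]
                norm_cast
                refine Finset.card_le_card fun V hV => Finset.mem_powersetCard.2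
                  ⟨Finset.subset_univ _, ?_⟩
                exact congrArg Prod.fst (Finset.mem_filter.1 hV).2
            _ ≤ 0.98 ^ (withRoots W U).card := h6
            _ ≤ 0.98 ^ W.card := pow_le_pow_of_le_one (by norm_num) (by norm_num) h2
    _ = _ := by
        rw [Finset.sum_const, Finset.card_product, Finset.card_range, nsmul_eq_mul]
        push_cast
        ring

/-! ### Random 2-SAT is unsatisfiable at density 8/5 -/

section Windows

variable {n m : ℕ}

lemma Implies.true_of_true {F : Formula 2 n m} {σ : Fin n → Bool}
    (hσ : ∀ i, ∃ l ∈ (F i).1, σ l.1 = l.2) {u w : Literal n} (h : Implies F u w)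
    (hu : σ u.1 = u.2) : σ w.1 = w.2 := by
  obtain ⟨i, hi⟩ := h
  obtain ⟨l, hl, hlσ⟩ := hσ i
  rw [hi, Finset.mem_insert, Finset.mem_singleton] at hl
  rcases hl with rfl | rfl
  · simp [Literal.neg, hu] at hlσ
  · exact hlσ

lemma reflTransGen_true_of_true {F : Formula 2 n m} {σ : Fin n → Bool}
    (hσ : ∀ i, ∃ l ∈ (F i).1, σ l.1 = l.2) {u w : Literal n}
    (h : Relation.ReflTransGen (Implies F) u w) (hu : σ u.1 = u.2) : σ w.1 = w.2 := by
  induction h with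
  | refl => exact hu
  | tail _ h ih => exact h.true_of_true hσ ih

/-- The `i`-th window of `s` consecutive variables. -/
def window (n s i : ℕ) : Finset (Fin n) := Finset.univ.filter fun v => v.1 / s = i

lemma card_window {s i : ℕ} (hs : 0 < s) (hi : i < n / s) : (window n s i).card = s := by
  have hlt : ∀ j < s, i * s + j < n := fun j hj => by
    have h1 : (i + 1) * s ≤ n / s * s := Nat.mul_le_mul_right s hi
    have h2 := Nat.div_mul_le_self n s
    nlinarith
  refine Eq.trans (Eq.symm ?_) (Finset.card_range s)
  refine Finset.card_bij (fun j hj => ⟨i * s + j, hlt j (Finset.mem_range.1 hj)⟩) ?_ ?_ ?_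
  · intro j hj
    refine Finset.mem_filter.2 ⟨Finset.mem_univ _, ?_⟩
    simp only
    rw [mul_comm, Nat.mul_add_div hs,
      Nat.div_eq_of_lt (by simpa using hj), add_zero]
  · intro j _ j' _ h
    have := Fin.mk.inj h
    omega
  · intro v hv
    have hv' : v.1 / s = i := (Finset.mem_filter.1 hv).2
    refine ⟨v.1 % s, Finset.mem_range.2 (Nat.mod_lt _ hs), Fin.ext ?_⟩
    have := Nat.div_add_mod v.1 s
    rw [hv'] at this
    simp only
    rw [mul_comm]
    exact this

/-- If every window is fruitful, there are few large consistent sets of literals such that every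
satisfying assignment makes all literals of one of them true: either a variable with many
consequences is true, or all such variables (one for each window) are false. -/
lemma exists_family_of_fruitful {F : Formula 2 n m} {s : ℕ} (hs : 0 < s)
    (h : ∀ i < n / s, Fruitful F (window n s i)) :
    ∃ 𝒬 : Finset (Finset (Literal n)), 𝒬.card ≤ n + 1 ∧
      (∀ Q ∈ 𝒬, Consistent Q ∧ n / (50 * s) ≤ Q.card) ∧
      ∀ σ : Fin n → Bool, (∀ i, ∃ l ∈ (F i).1, σ l.1 = l.2) →
        ∃ Q ∈ 𝒬, ∀ l ∈ Q, σ l.1 = l.2 := by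
  classical
  have h' : ∀ i : Fin (n / s), Fruitful F (window n s i) := fun i => h i i.2
  choose x hx Q hQ hreach hcard using h'
  have hxinj : Function.Injective x := fun i j hij => by
    have h1 := (Finset.mem_filter.1 (hx i)).2
    have h2 := (Finset.mem_filter.1 (hx j)).2
    rw [hij] at h1
    exact Fin.ext (h1.symm.trans h2)
  have hfinj : Function.Injective fun i => ((x i, false) : Literal n) := fun i j hij =>
    hxinj (Prod.mk.inj hij).1
  refine ⟨insert (Finset.univ.image fun i => (x i, false)) (Finset.univ.image Q), ?_, ?_, ?_⟩
  · refine (Finset.card_insert_le _ _).trans (Nat.add_le_add_right ?_ 1)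
    refine Finset.card_image_le.trans ?_
    rw [Finset.card_univ, Fintype.card_fin]
    exact Nat.div_le_self n s
  · intro P hP
    rcases Finset.mem_insert.1 hP with rfl | hP
    · constructor
      · intro a ha b hb hab
        obtain ⟨i, -, rfl⟩ := Finset.mem_image.1 (Finset.mem_coe.1 ha)
        obtain ⟨j, -, rfl⟩ := Finset.mem_image.1 (Finset.mem_coe.1 hb)
        simp only at hab
        rw [hab]
      · rw [Finset.card_image_of_injective _ hfinj, Finset.card_univ, Fintype.card_fin]
        exact Nat.div_le_div_left (by omega) hs
    · obtain ⟨i, -, rfl⟩ := Finset.mem_image.1 hP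
      refine ⟨hQ i, ?_⟩
      have := hcard i
      rw [card_window hs i.2] at this
      exact Nat.div_le_of_le_mul this
  · intro σ hσ
    by_cases hall : ∀ i, σ (x i) = false
    · refine ⟨_, Finset.mem_insert_self _ _, fun l hl => ?_⟩
      obtain ⟨i, -, rfl⟩ := Finset.mem_image.1 hl
      exact hall i
    · push Not at hall
      obtain ⟨i, hi⟩ := hall
      refine ⟨Q i, Finset.mem_insert_of_mem (Finset.mem_image_of_mem _ (Finset.mem_univ i)),
        fun l hl => reflTransGen_true_of_true hσ (hreach i l hl) (by simpa using hi)⟩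

lemma choose_two_div_le_one (hn : 2 ≤ n) {L : ℕ} (hL : L ≤ n) :
    (L.choose 2 : ℝ) / (2 * n * (n - 1)) ≤ 1 := by
  have hn' : (2 : ℝ) ≤ n := by exact_mod_cast hn
  have h : (L.choose 2 : ℝ) ≤ n * (n - 1) / 2 := by
    rw [← Nat.cast_choose_two]
    exact_mod_cast Nat.choose_le_choose 2 hL
  rw [div_le_one (by nlinarith)]
  nlinarith

/-- Fresh clauses are likely to violate each of the sets of `exists_family_of_fruitful`. -/
lemma iidProb_satisfiable_append_le (hn : 2 ≤ n) {F : Formula 2 n m} {s : ℕ} (hs : 0 < s)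
    (h : ∀ i < n / s, Fruitful F (window n s i)) (b : ℕ) :
    iidProb (unifClause 2 n) b (fun G => Satisfiable (k := 2) (Fin.append F G)) ≤
      (n + 1) * (1 - (n / (50 * s)).choose 2 / (2 * n * (n - 1))) ^ b := by
  classical
  have hq := unifClause_nonneg 2 n
  obtain ⟨𝒬, h1, h2, h3⟩ := exists_family_of_fruitful hs h
  have hN : (0 : ℝ) < 2 * n * (n - 1) := by
    have : (2 : ℝ) ≤ n := by exact_mod_cast hn
    nlinarith
  have hle : ∀ Q ∈ 𝒬, iidProb (unifClause 2 n) b (fun G => ∀ i, G i ∈ (killingClauses Q)ᶜ) ≤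
      (1 - (n / (50 * s)).choose 2 / (2 * n * (n - 1)) : ℝ) ^ b := by
    intro Q hQ
    rw [iidProb_forall_mem]
    refine pow_le_pow_left₀ (Finset.sum_nonneg fun c _ => hq c) ?_ b
    have h4 := Finset.sum_add_sum_compl (killingClauses Q) (unifClause 2 n)
    rw [sum_unifClause hn, sum_unifClause_finset, card_clause_two] at h4
    have h5 : ((n / (50 * s)).choose 2 : ℝ) / (2 * n * (n - 1)) ≤
        (killingClauses Q).card / (2 * n * (n - 1)) := by
      refine div_le_div_of_nonneg_right ?_ hN.le
      exact_mod_cast (Nat.choose_le_choose 2 (h2 Q hQ).2).trans (le_card_killingClauses (h2 Q hQ).1)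
    linarith
  calc _ ≤ iidProb (unifClause 2 n) b (fun G => ∃ Q ∈ 𝒬, ∀ i, G i ∈ (killingClauses Q)ᶜ) := by
        refine iidProb_mono hq fun G hG => ?_
        obtain ⟨σ, hσ⟩ := hG
        obtain ⟨Q, hQ, hQσ⟩ := h3 σ fun i => by simpa using hσ (Fin.castAdd b i)
        refine ⟨Q, hQ, fun i => Finset.mem_compl.2 fun hi => ?_⟩
        obtain ⟨l, hl, hlσ⟩ := hσ (Fin.natAdd m i)
        rw [Fin.append_right] at hl
        have := hQσ _ ((Finset.mem_filter.1 hi).2 l hl)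
        rw [Literal.neg_fst, hlσ] at this
        simp [Literal.neg] at this
    _ ≤ ∑ Q ∈ 𝒬, (1 - (n / (50 * s)).choose 2 / (2 * n * (n - 1)) : ℝ) ^ b :=
        (iidProb_exists_le hq _ _).trans (Finset.sum_le_sum hle)
    _ = 𝒬.card * (1 - (n / (50 * s)).choose 2 / (2 * n * (n - 1)) : ℝ) ^ b := by
        rw [Finset.sum_const, nsmul_eq_mul]
    _ ≤ _ := by
        refine mul_le_mul_of_nonneg_right (by exact_mod_cast h1) ?_
        exact pow_nonneg (sub_nonneg.2 (choose_two_div_le_one hn (Nat.div_le_self _ _))) b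

/-- The first clauses make all windows fruitful, and `b` fresh clauses then exclude all
assignments. -/
lemma randomSatProb_two_le (hn : 1000 ≤ n) {s : ℕ} (hs : 0 < s) (b : ℕ) :
    randomSatProb 2 n (⌊(3 / 2 : ℝ) * n⌋₊ + b) ≤ n * ((n + 1) ^ 2 * 0.98 ^ s) +
      (n + 1) * (1 - (n / (50 * s)).choose 2 / (2 * n * (n - 1))) ^ b := by
  classical
  have hq := unifClause_nonneg 2 n
  have hn2 : 2 ≤ n := by omega
  set m := ⌊(3 / 2 : ℝ) * n⌋₊ with hm
  set y : ℝ := (n + 1) * (1 - (n / (50 * s)).choose 2 / (2 * n * (n - 1))) ^ b with hy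
  have hy0 : 0 ≤ y := mul_nonneg (by positivity)
    (pow_nonneg (sub_nonneg.2 (choose_two_div_le_one hn2 (Nat.div_le_self _ _))) b)
  set E : Formula 2 n m → Prop := fun F => ∃ i ∈ Finset.range (n / s),
    ¬ Fruitful F (window n s i) with hE
  have hEle : iidProb (unifClause 2 n) m E ≤ n * ((n + 1) ^ 2 * 0.98 ^ s) := by
    refine (iidProb_exists_le hq _ _).trans ?_
    calc _ ≤ ∑ i ∈ Finset.range (n / s), ((n + 1) ^ 2 * 0.98 ^ s : ℝ) := by
          refine Finset.sum_le_sum fun i hi => ?_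
          have hw := card_window hs (Finset.mem_range.1 hi)
          have := iidProb_not_fruitful_le hn (W := window n s i)
            (Finset.card_pos.1 (by rw [hw]; exact hs))
          rwa [hw] at this
      _ = (n / s : ℕ) * ((n + 1) ^ 2 * 0.98 ^ s : ℝ) := by
          rw [Finset.sum_const, Finset.card_range, nsmul_eq_mul]
      _ ≤ _ := by
          refine mul_le_mul_of_nonneg_right ?_ (by positivity)
          exact_mod_cast Nat.div_le_self n s
  rw [randomSatProb_eq_iidProb, iidProb_add]
  calc _ ≤ ∑ F : Fin m → Clause 2 n, ((if E F then ∏ i, unifClause 2 n (F i) else 0) +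
        (∏ i, unifClause 2 n (F i)) * y) := by
        refine Finset.sum_le_sum fun F _ => ?_
        have hp : 0 ≤ ∏ i, unifClause 2 n (F i) := Finset.prod_nonneg fun i _ => hq _
        by_cases hF : E F
        · rw [if_pos hF]
          have h1 := mul_le_of_le_one_right hp (iidProb_le_one hq (sum_unifClause hn2)
            (fun G : Formula 2 n b => Satisfiable (k := 2) (Fin.append F G)))
          have h2 := mul_nonneg hp hy0
          linarith
        · rw [if_neg hF, zero_add]
          refine mul_le_mul_of_nonneg_left ?_ hp
          simp only [hE, not_exists, not_and, not_not, Finset.mem_range] at hF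
          exact iidProb_satisfiable_append_le hn2 hs hF b
    _ = iidProb (unifClause 2 n) m E + y := by
        rw [Finset.sum_add_distrib, ← Finset.sum_mul]
        have : ∑ F : Fin m → Clause 2 n, ∏ i, unifClause 2 n (F i) = 1 := by
          have := iidProb_true (q := unifClause 2 n) (m := m)
          rw [sum_unifClause hn2, one_pow] at this
          simpa [iidProb] using this
        rw [this, one_mul]
        simp only [iidProb]
        congr!
    _ ≤ _ := add_le_add_left hEle y

end Windows

/-- Random 2-SAT is unsatisfiable at density `8 / 5`: most clauses build the large sets of
consequences, and a few more violate them. -/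
lemma tendsto_randomSatProb_two :
    Tendsto (fun n : ℕ => randomSatProb 2 n ⌊(8 / 5 : ℝ) * n⌋₊) atTop (𝓝 0) := by
  -- windows of about `n ^ (1 / 4)` variables
  set s : ℕ → ℕ := fun n => n.sqrt.sqrt with hs
  have hs_top : Tendsto s atTop atTop := by
    refine tendsto_atTop.2 fun b => ?_
    filter_upwards [eventually_ge_atTop (b ^ 2 * b ^ 2)] with n hn
    exact Nat.le_sqrt'.2 (Nat.le_sqrt'.2 (by nlinarith))
  have hlow : ∀ n, s n ^ 4 ≤ n := fun n => by
    have h1 := Nat.sqrt_le' n.sqrt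
    have h2 := Nat.sqrt_le' n
    calc s n ^ 4 = (s n ^ 2) ^ 2 := by ring
      _ ≤ n.sqrt ^ 2 := Nat.pow_le_pow_left h1 2
      _ ≤ n := h2
  have hup : ∀ n, n + 1 ≤ (s n + 1) ^ 4 := fun n => by
    have h1 := Nat.succ_le_succ_sqrt' n.sqrt
    have h2 := Nat.succ_le_succ_sqrt' n
    calc n + 1 ≤ (n.sqrt + 1) ^ 2 := h2
      _ ≤ ((s n + 1) ^ 2) ^ 2 := Nat.pow_le_pow_left h1 2
      _ = _ := by ring
  set ρ : ℝ := Real.exp (-(1 / 1000000)) with hρ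
  have hlim : Tendsto (fun n : ℕ => ((s n : ℝ) + 1) ^ 12 * 0.98 ^ s n +
      ((s n : ℝ) + 1) ^ 4 * ρ ^ s n) atTop (𝓝 0) := by
    have hpow : ∀ (j : ℕ) (r : ℝ), 0 < r → r < 1 →
        Tendsto (fun i : ℕ => ((i : ℝ) + 1) ^ j * r ^ i) atTop (𝓝 0) := by
      intro j r h0 h1
      have := ((tendsto_pow_const_mul_const_pow_of_lt_one j h0.le h1).comp
        (tendsto_add_atTop_nat 1)).const_mul r⁻¹
      rw [mul_zero] at this
      refine this.congr fun i => ?_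
      simp only [Function.comp]
      push_cast
      rw [pow_succ]
      field_simp
    have h1 := (hpow 12 0.98 (by norm_num) (by norm_num)).comp hs_top
    have h2 := (hpow 4 ρ (Real.exp_pos _) (by rw [hρ, Real.exp_lt_one_iff]; norm_num)).comp hs_top
    simpa using h1.add h2
  refine tendsto_of_tendsto_of_tendsto_of_le_of_le' tendsto_const_nhds hlim
    (Eventually.of_forall fun n => randomSatProb_nonneg _ _ _) ?_
  filter_upwards [eventually_ge_atTop 1000, hs_top.eventually_ge_atTop 200] with n hn hs200
  set a := s n with ha
  have ha0 : 0 < a := by omega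
  set m := ⌊(3 / 2 : ℝ) * n⌋₊ with hm
  set b := ⌊(8 / 5 : ℝ) * n⌋₊ - m with hb
  have hn' : (1000 : ℝ) ≤ n := by exact_mod_cast hn
  have hmb : ⌊(8 / 5 : ℝ) * n⌋₊ = m + b := by
    have : m ≤ ⌊(8 / 5 : ℝ) * n⌋₊ := Nat.floor_le_floor (by linarith)
    omega
  have hb1 : (1 / 20 : ℝ) * n ≤ b := by
    have h1 : (8 / 5 : ℝ) * n - 1 ≤ (⌊(8 / 5 : ℝ) * n⌋₊ : ℝ) := (Nat.sub_one_lt_floor _).le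
    have h2 : (m : ℝ) ≤ 3 / 2 * n := Nat.floor_le (by positivity)
    rw [hmb] at h1
    push_cast at h1
    linarith
  have hup' : (n : ℝ) + 1 ≤ ((a : ℝ) + 1) ^ 4 := by exact_mod_cast hup n
  have hlow' : (a : ℝ) ^ 4 ≤ n := by exact_mod_cast hlow n
  have ha' : (200 : ℝ) ≤ a := by exact_mod_cast hs200
  rw [hmb]
  refine (randomSatProb_two_le hn ha0 b).trans (add_le_add ?_ ?_)
  · rw [← mul_assoc]
    refine mul_le_mul_of_nonneg_right ?_ (by positivity)
    calc (n : ℝ) * (n + 1) ^ 2 ≤ ((n : ℝ) + 1) * (n + 1) ^ 2 := by gcongr; linarith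
      _ = ((n : ℝ) + 1) ^ 3 := by ring
      _ ≤ (((a : ℝ) + 1) ^ 4) ^ 3 := by gcongr
      _ = _ := by ring
  · set L := n / (50 * a) with hL
    have hL1 : (n : ℝ) / (50 * a) - 1 ≤ L := by
      have h1 : n < 50 * a * (L + 1) := by
        rw [mul_comm]; exact Nat.lt_mul_of_div_lt (Nat.lt_succ_self _) (by omega)
      have h2 : (n : ℝ) < 50 * a * (L + 1) := by exact_mod_cast h1
      rw [sub_le_iff_le_add, div_le_iff₀ (by positivity)]
      linarith
    have hna : (50 * a : ℝ) * 100 ≤ n := by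
      nlinarith [pow_le_pow_left₀ (by norm_num) ha' 3]
    have hL2 : (n : ℝ) / (50 * a) ≥ 100 := (le_div_iff₀ (by positivity)).2 (by linarith)
    have hL3 : (n : ℝ) / (50 * a) / 2 ≤ L - 1 := by linarith
    have hL4 : ((n : ℝ) / (50 * a)) ^ 2 / 8 ≤ (L.choose 2 : ℕ) := by
      rw [Nat.cast_choose_two]
      nlinarith
    have hN : (0 : ℝ) < 2 * n * (n - 1) := by nlinarith
    -- `L` is about `n / (50 * a)`, so that a fresh clause is killing with probability of order
    -- `a ^ (-2)`, while there are at least `n / 20 ≥ a ^ 4 / 20` of them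
    have hfrac : 1 / (50000 * (a : ℝ) ^ 2) ≤ (L.choose 2 : ℕ) / (2 * n * (n - 1)) := by
      rw [le_div_iff₀ hN]
      refine le_trans ?_ hL4
      have : ((n : ℝ) / (50 * a)) ^ 2 / 8 = 1 / (50000 * (a : ℝ) ^ 2) * (2 * n * n) * (10 / 8) := by
        field_simp; norm_num
      rw [this]
      have h1 : 0 < 1 / (50000 * (a : ℝ) ^ 2) := by positivity
      have h2 : (2 * n * (n - 1) : ℝ) ≤ 2 * n * n * (10 / 8) := by nlinarith
      nlinarith [mul_le_mul_of_nonneg_left h2 h1.le]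
    have hbase0 : (0 : ℝ) ≤ 1 - (L.choose 2 : ℕ) / (2 * n * (n - 1)) :=
      sub_nonneg.2 (choose_two_div_le_one (by omega) (Nat.div_le_self _ _))
    have hbase : 1 - (L.choose 2 : ℕ) / (2 * n * (n - 1) : ℝ) ≤
        Real.exp (-(1 / (50000 * (a : ℝ) ^ 2))) := by
      have := Real.add_one_le_exp (-(1 / (50000 * (a : ℝ) ^ 2)))
      linarith
    refine mul_le_mul hup' ?_ (by positivity) (by positivity)
    refine (pow_le_pow_left₀ hbase0 hbase b).trans ?_
    rw [hρ, ← Real.exp_nat_mul, ← Real.exp_nat_mul, Real.exp_le_exp]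
    have h1 : (a : ℝ) * (1 / 1000000) ≤ b * (1 / (50000 * (a : ℝ) ^ 2)) := by
      rw [mul_one_div, mul_one_div, div_le_div_iff₀ (by norm_num) (by positivity)]
      have h2 : (a : ℝ) ^ 3 ≤ a ^ 4 := pow_le_pow_right₀ (by linarith) (by norm_num)
      nlinarith
    linarith

/-! ### The reduction to 2-clauses -/

section probOn

variable {Ω : Type} {s : Finset Ω} {E : Ω → Prop}

lemma probOn_eq_sum_div [DecidablePred E] :
    probOn s E = (∑ a ∈ s, if E a then 1 else 0) / s.card := by
  unfold probOn
  rw [Finset.sum_boole]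
  congr!

lemma probOn_le_one : probOn s E ≤ 1 := by
  classical
  rw [probOn_eq_sum_div, Finset.sum_boole]
  exact div_le_one_of_le₀ (by exact_mod_cast Finset.card_filter_le _ _) (by positivity)

lemma probOn_eq_one (hs : s.Nonempty) (h : ∀ a ∈ s, E a) : probOn s E = 1 := by
  classical
  have := hs.card_pos
  rw [probOn_eq_sum_div, Finset.sum_boole, Finset.filter_true_of_mem h, div_self (by positivity)]

lemma probOn_eq_zero (h : ∀ a ∈ s, ¬ E a) : probOn s E = 0 := by
  classical
  rw [probOn_eq_sum_div, Finset.sum_boole, Finset.filter_false_of_mem h]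
  simp

end probOn

section Reduced

variable {k n t : ℕ}

/-- A subset of size `j` of a clause, as a `j`-clause. -/
def Clause.sub {j : ℕ} (c : Clause k n) (D : Finset (Literal n)) (hD : D ⊆ c.1)
    (hj : D.card = j) : Clause j n :=
  ⟨D, hj, fun a ha b hb h => c.2.2 a (hD ha) b (hD hb) h⟩

/-- A clause contains a 2-clause with as many positive literals as possible. -/
lemma exists_pair_numPos (hk : 2 ≤ k) (c : Clause k n) :
    ∃ d : Clause 2 n, d.1 ⊆ c.1 ∧ min 2 c.numPos ≤ d.numPos := by
  classical
  set P := c.1.filter fun l => l.2 = true with hP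
  have hPc : P ⊆ c.1 := Finset.filter_subset _ _
  have hPn : P.card = c.numPos := rfl
  rcases le_total P.card 2 with h | h
  · obtain ⟨D, h1, h2, h3⟩ := Finset.exists_subsuperset_card_eq hPc h (by rw [c.2.1]; exact hk)
    refine ⟨c.sub D h2 h3, h2, (min_le_right _ _).trans ?_⟩
    refine hPn ▸ Finset.card_le_card fun l hl => Finset.mem_filter.2 ⟨h1 hl, ?_⟩
    exact (Finset.mem_filter.1 hl).2
  · obtain ⟨D, h1, h2⟩ := Finset.exists_subset_card_eq h
    refine ⟨c.sub D (h1.trans hPc) h2, h1.trans hPc, (min_le_left _ _).trans ?_⟩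
    refine h2.symm.le.trans (Finset.card_le_card fun l hl => Finset.mem_filter.2 ⟨hl, ?_⟩)
    exact (Finset.mem_filter.1 (h1 hl)).2

lemma mem_mostPositivePairs {c : Clause k n} {d : Clause 2 n} :
    d ∈ mostPositivePairs c ↔
      d.1 ⊆ c.1 ∧ ∀ d' : Clause 2 n, d'.1 ⊆ c.1 → d'.numPos ≤ d.numPos := by
  simp [mostPositivePairs]

lemma mostPositivePairs_nonempty (hk : 2 ≤ k) (c : Clause k n) :
    (mostPositivePairs c).Nonempty := by
  obtain ⟨d, hd, -⟩ := exists_pair_numPos hk c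
  obtain ⟨e, he, hmax⟩ := Finset.exists_max_image
    (Finset.univ.filter fun d : Clause 2 n => d.1 ⊆ c.1) Clause.numPos
    ⟨d, Finset.mem_filter.2 ⟨Finset.mem_univ _, hd⟩⟩
  exact ⟨e, mem_mostPositivePairs.2 ⟨(Finset.mem_filter.1 he).2, fun d' hd' =>
    hmax d' (Finset.mem_filter.2 ⟨Finset.mem_univ _, hd'⟩)⟩⟩

lemma numPos_of_mem_mostPositivePairs (hk : 2 ≤ k) {c : Clause k n} {d : Clause 2 n}
    (hd : d ∈ mostPositivePairs c) : d.numPos = min 2 c.numPos := by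
  obtain ⟨h1, h2⟩ := mem_mostPositivePairs.1 hd
  obtain ⟨e, he, he'⟩ := exists_pair_numPos hk c
  refine le_antisymm (le_min d.numPos_le ?_) (he'.trans (h2 e he))
  exact Finset.card_le_card (Finset.filter_subset_filter _ h1)

/-- The clause that is kept from the offer `o`. -/
def keptClause (r : (Fin t → ℕ) → Fin t) (o : Offer t k n) : Clause k n :=
  o (r fun i => (o i).numPos)

open Classical in
/-- The law of the 2-clause that is obtained in one step. -/
noncomputable def reducedLaw (k : ℕ) (r : (Fin t → ℕ) → Fin t) (n : ℕ) (d : Clause 2 n) : ℝ :=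
  Finset.expect (Finset.univ : Finset (Offer t k n)) fun o =>
    if d ∈ mostPositivePairs (keptClause r o) then
      ((mostPositivePairs (keptClause r o)).card : ℝ)⁻¹ else 0

lemma reducedLaw_nonneg (r : (Fin t → ℕ) → Fin t) (d : Clause 2 n) : 0 ≤ reducedLaw k r n d := by
  classical
  refine Finset.expect_nonneg fun o _ => ?_
  split_ifs <;> positivity

lemma sum_reducedLaw_filter (hk : 2 ≤ k) (r : (Fin t → ℕ) → Fin t) (j : ℕ) :
    ∑ d ∈ Finset.univ.filter (fun d : Clause 2 n => d.numPos = j), reducedLaw k r n d =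
      Finset.expect (Finset.univ : Finset (Offer t k n)) fun o =>
        if min 2 (keptClause r o).numPos = j then 1 else 0 := by
  classical
  unfold reducedLaw
  rw [← Finset.expect_sum_comm]
  refine Finset.expect_congr rfl fun o _ => ?_
  have hne := (mostPositivePairs_nonempty hk (keptClause r o)).card_pos
  rw [← Finset.sum_filter, Finset.sum_const, nsmul_eq_mul, Finset.filter_filter]
  split_ifs with h
  · have : (Finset.univ.filter fun d : Clause 2 n =>
        d.numPos = j ∧ d ∈ mostPositivePairs (keptClause r o)) =
        mostPositivePairs (keptClause r o) := by
      ext d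
      simp only [Finset.mem_filter, Finset.mem_univ, true_and, and_iff_right_iff_imp]
      exact fun hd => (numPos_of_mem_mostPositivePairs hk hd).trans h
    rw [this]
    have : ((mostPositivePairs (keptClause r o)).card : ℝ) ≠ 0 := by positivity
    field_simp
  · have : (Finset.univ.filter fun d : Clause 2 n =>
        d.numPos = j ∧ d ∈ mostPositivePairs (keptClause r o)) = ∅ := by
      refine Finset.filter_eq_empty_iff.2 fun d _ hd => h ?_
      rw [← numPos_of_mem_mostPositivePairs hk hd.2, hd.1]
    simp [this]

lemma reducedSignProb_eq_sum (hk : 2 ≤ k) (r : (Fin t → ℕ) → Fin t) (j : ℕ) :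
    reducedSignProb k r n j =
      ∑ d ∈ Finset.univ.filter (fun d : Clause 2 n => d.numPos = j), reducedLaw k r n d := by
  classical
  rw [sum_reducedLaw_filter hk, reducedSignProb]
  refine Finset.expect_congr rfl fun o _ => ?_
  change probOn (mostPositivePairs (keptClause r o)) _ = _
  split_ifs with h
  · exact probOn_eq_one (mostPositivePairs_nonempty hk _) fun d hd =>
      (numPos_of_mem_mostPositivePairs hk hd).trans h
  · exact probOn_eq_zero fun d hd hd' =>
      h ((numPos_of_mem_mostPositivePairs hk hd).symm.trans hd')

/-- With a maximum rule, the kept clause has at most `a` positive literals exactly when all clauses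
on offer have at most `a`. -/
lemma expect_numPos_keptClause_le {r : (Fin t → ℕ) → Fin t} (hr : IsMaxRule r) (a : ℕ) :
    (Finset.expect (Finset.univ : Finset (Offer t k n)) fun o =>
        if (keptClause r o).numPos ≤ a then (1 : ℝ) else 0) =
      (((Finset.univ.filter fun c : Clause k n => c.numPos ≤ a).card : ℝ) /
        Fintype.card (Clause k n)) ^ t := by
  classical
  have h : (Finset.univ.filter fun o : Offer t k n => (keptClause r o).numPos ≤ a) =
      Fintype.piFinset fun _ => Finset.univ.filter fun c : Clause k n => c.numPos ≤ a := by
    ext o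
    simp only [Finset.mem_filter, Finset.mem_univ, true_and, Fintype.mem_piFinset]
    exact ⟨fun h i => (hr (fun i => (o i).numPos) i).trans h, fun h => h _⟩
  rw [Finset.expect_eq_sum_div_card, Finset.sum_boole, h, Fintype.card_piFinset_const,
    Finset.card_univ, Fintype.card_fun, Fintype.card_fin]
  push_cast
  rw [div_pow]

lemma card_filter_numPos_le_one :
    (Finset.univ.filter fun c : Clause k n => c.numPos ≤ 1).card = n.choose k * (k + 1) := by
  have : (Finset.univ.filter fun c : Clause k n => c.numPos ≤ 1) =
      (Finset.univ.filter fun c : Clause k n => c.numPos = 0) ∪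
        Finset.univ.filter fun c : Clause k n => c.numPos = 1 := by
    ext c
    simp only [Finset.mem_filter, Finset.mem_union, Finset.mem_univ, true_and]
    omega
  rw [this, Finset.card_union_of_disjoint (Finset.disjoint_filter.2 fun c _ h => by omega),
    Clause.card_filter_numPos, Clause.card_filter_numPos, Nat.choose_zero_right, Nat.choose_one_right]
  ring

lemma offer_nonempty (hkn : k ≤ n) : Nonempty (Offer t k n) :=
  ⟨fun _ => (Fintype.card_pos_iff.1 (Clause.card_pos hkn)).some⟩

/-- The sign probabilities of the 2-clause obtained in one step. -/
lemma reducedSignProb_eq (hk : 2 ≤ k) (hkn : k ≤ n) {r : (Fin t → ℕ) → Fin t}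
    (hr : IsMaxRule r) :
    reducedSignProb k r n 0 = pZero k t ∧ reducedSignProb k r n 1 = pOne k t ∧
      reducedSignProb k r n 2 = pTwo k t := by
  classical
  have hch : (n.choose k : ℝ) ≠ 0 := by exact_mod_cast (Nat.choose_pos hkn).ne'
  have hcard : (Fintype.card (Clause k n) : ℝ) = n.choose k * 2 ^ k := by
    rw [Clause.card_eq]; push_cast; ring
  have h0 := expect_numPos_keptClause_le (k := k) (n := n) hr 0
  have h1 := expect_numPos_keptClause_le (k := k) (n := n) hr 1
  have e0 : (Finset.univ.filter fun c : Clause k n => c.numPos ≤ 0).card = n.choose k := by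
    simp only [Nat.le_zero]
    rw [Clause.card_filter_numPos, Nat.choose_zero_right, mul_one]
  rw [e0, hcard, ← div_div, div_self hch, one_div, ← one_div, div_pow, one_pow, ← pow_mul] at h0
  rw [card_filter_numPos_le_one, hcard, Nat.cast_mul, mul_div_mul_left _ _ hch] at h1
  push_cast at h1
  change _ = pZero k t at h0
  have := offer_nonempty (t := t) hkn
  have h2 : (Finset.expect (Finset.univ : Finset (Offer t k n)) fun _ => (1 : ℝ)) = 1 :=
    Finset.expect_const Finset.univ_nonempty 1
  simp only [reducedSignProb_eq_sum hk, sum_reducedLaw_filter hk]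
  refine ⟨?_, ?_, ?_⟩
  · rw [← h0]
    refine Finset.expect_congr rfl fun o _ => if_congr ?_ rfl rfl
    omega
  · rw [pOne, ← h0, ← h1, ← Finset.expect_sub_distrib]
    refine Finset.expect_congr rfl fun o _ => ?_
    split_ifs <;> first | omega | norm_num
  · rw [pTwo, pOne, sub_sub, add_sub_cancel, ← h1, ← h2, ← Finset.expect_sub_distrib]
    refine Finset.expect_congr rfl fun o _ => ?_
    split_ifs <;> first | omega | norm_num

lemma sum_reducedLaw (hk : 2 ≤ k) (hkn : k ≤ n) {r : (Fin t → ℕ) → Fin t} (hr : IsMaxRule r) :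
    ∑ d, reducedLaw k r n d = 1 := by
  rw [← Finset.sum_fiberwise_of_maps_to (s := Finset.univ) (t := Finset.range 3)
    (g := Clause.numPos) (fun d _ => Finset.mem_range.2 (Nat.lt_succ_of_le d.numPos_le))]
  obtain ⟨h0, h1, h2⟩ := reducedSignProb_eq hk hkn hr
  rw [reducedSignProb_eq_sum hk] at h0 h1 h2
  rw [Finset.sum_range_succ, Finset.sum_range_succ, Finset.sum_range_one, h0, h1, h2, pTwo]
  ring

/-- The reduced clauses of the steps are independent with law `reducedLaw`. -/
lemma reducedSatProb_eq_iidProb (r : (Fin t → ℕ) → Fin t) (m : ℕ) :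
    (mostPositiveStrategy k r n).reducedSatProb m =
      iidProb (reducedLaw k r n) m Satisfiable := by
  classical
  set g : Clause 2 n → Offer t k n → ℝ := fun d o =>
    if d ∈ mostPositivePairs (keptClause r o) then
      ((mostPositivePairs (keptClause r o)).card : ℝ)⁻¹ else 0 with hg
  have h1 : ∀ ω : Fin m → Offer t k n,
      probOn (Fintype.piFinset fun i =>
        mostPositivePairs ((mostPositiveStrategy k r n).formula ω i)) Satisfiable =
      ∑ F : Formula 2 n m, if Satisfiable F then ∏ i, g (F i) (ω i) else 0 := by
    intro ω
    change probOn (Fintype.piFinset fun i => mostPositivePairs (keptClause r (ω i))) _ = _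
    rw [probOn_eq_sum_div, Fintype.card_piFinset, Finset.sum_div, ← Finset.univ_inter
      (Fintype.piFinset fun i => mostPositivePairs (keptClause r (ω i))), ← Finset.sum_ite_mem]
    refine Finset.sum_congr rfl fun F _ => ?_
    by_cases hS : Satisfiable F
    · by_cases hF : F ∈ Fintype.piFinset fun i => mostPositivePairs (keptClause r (ω i))
      · rw [if_pos hF, if_pos hS, if_pos hS]
        rw [Fintype.mem_piFinset] at hF
        simp only [hg, hF, if_true]
        push_cast
        rw [Finset.prod_inv_distrib, one_div]
      · rw [if_neg hF, if_pos hS]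
        rw [Fintype.mem_piFinset] at hF
        obtain ⟨i, hi⟩ := not_forall.1 hF
        exact (Finset.prod_eq_zero (Finset.mem_univ i) (by simp [hg, hi])).symm
    · simp [hS]
  unfold OnlineStrategy.reducedSatProb
  simp only [h1]
  rw [Finset.expect_sum_comm]
  unfold iidProb
  refine Finset.sum_congr rfl fun F _ => ?_
  by_cases hS : Satisfiable F
  · simp only [hS, if_true]
    rw [Finset.expect_eq_sum_div_card, ← Fintype.piFinset_univ, ← Finset.prod_univ_sum]
    simp only [reducedLaw, Finset.expect_eq_sum_div_card, Finset.prod_div_distrib]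
    congr 1
    simp
  · simp [hS]

/-- A clause is satisfied as soon as a 2-clause contained in it is. -/
lemma reducedSatProb_le_satProb (S : OnlineStrategy t k n) (m : ℕ) :
    S.reducedSatProb m ≤ S.satProb m := by
  classical
  unfold OnlineStrategy.reducedSatProb OnlineStrategy.satProb
  rw [probOn_eq_sum_div, Finset.expect_eq_sum_div_card]
  refine div_le_div_of_nonneg_right (Finset.sum_le_sum fun ω _ => ?_) (by positivity)
  split_ifs with h
  · exact probOn_le_one
  · refine (probOn_eq_zero fun F hF hSat => h ?_).le
    obtain ⟨σ, hσ⟩ := hSat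
    refine ⟨σ, fun i => ?_⟩
    obtain ⟨l, hl, hlσ⟩ := hσ i
    exact ⟨l, (mem_mostPositivePairs.1 (Fintype.mem_piFinset.1 hF i)).1 hl, hlσ⟩

lemma satProb_le_one (S : OnlineStrategy t k n) (m : ℕ) : S.satProb m ≤ 1 := probOn_le_one

end Reduced

/-! ### The law of the reduced clause -/

/-- The action of a permutation of the variables on literals. -/
def Literal.perm {n : ℕ} (π : Equiv.Perm (Fin n)) : Literal n ≃ Literal n :=
  Equiv.prodCongr π (Equiv.refl Bool)

/-- The action of a permutation of the variables on clauses. -/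
def Clause.perm {k n : ℕ} (π : Equiv.Perm (Fin n)) : Clause k n ≃ Clause k n where
  toFun c := ⟨c.1.map (Literal.perm π).toEmbedding, by rw [Finset.card_map, c.2.1], by
    intro a ha b hb hab
    obtain ⟨a', ha', rfl⟩ := Finset.mem_map.1 ha
    obtain ⟨b', hb', rfl⟩ := Finset.mem_map.1 hb
    exact congrArg _ (c.2.2 a' ha' b' hb' (π.injective hab))⟩
  invFun c := ⟨c.1.map (Literal.perm π).symm.toEmbedding, by rw [Finset.card_map, c.2.1], by
    intro a ha b hb hab
    obtain ⟨a', ha', rfl⟩ := Finset.mem_map.1 ha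
    obtain ⟨b', hb', rfl⟩ := Finset.mem_map.1 hb
    exact congrArg _ (c.2.2 a' ha' b' hb' (π.symm.injective hab))⟩
  left_inv c := Subtype.ext (by simp [Finset.map_map])
  right_inv c := Subtype.ext (by simp [Finset.map_map])

section Symmetry

variable {k n t : ℕ}

lemma Clause.numPos_perm (π : Equiv.Perm (Fin n)) (c : Clause k n) :
    (Clause.perm π c).numPos = c.numPos := by
  unfold Clause.numPos
  change ((c.1.map (Literal.perm π).toEmbedding).filter fun l => l.2 = true).card = _
  rw [Finset.filter_map, Finset.card_map]
  rfl

lemma Clause.perm_subset_perm {j : ℕ} (π : Equiv.Perm (Fin n)) (d : Clause j n) (c : Clause k n) :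
    (Clause.perm π d).1 ⊆ (Clause.perm π c).1 ↔ d.1 ⊆ c.1 :=
  Finset.map_subset_map

lemma mem_mostPositivePairs_perm (π : Equiv.Perm (Fin n)) (c : Clause k n) (d : Clause 2 n) :
    Clause.perm π d ∈ mostPositivePairs (Clause.perm π c) ↔ d ∈ mostPositivePairs c := by
  rw [mem_mostPositivePairs, mem_mostPositivePairs, Clause.perm_subset_perm, Clause.numPos_perm,
    ← (Clause.perm π).forall_congr_right]
  simp only [Clause.perm_subset_perm, Clause.numPos_perm]

lemma card_mostPositivePairs_perm (π : Equiv.Perm (Fin n)) (c : Clause k n) :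
    (mostPositivePairs (Clause.perm π c)).card = (mostPositivePairs c).card := by
  symm
  refine Finset.card_bij (fun d _ => Clause.perm π d)
    (fun d hd => (mem_mostPositivePairs_perm π c d).2 hd)
    (fun d _ e _ h => (Clause.perm π).injective h) fun d hd => ?_
  obtain ⟨e, rfl⟩ := (Clause.perm π).surjective d
  exact ⟨e, (mem_mostPositivePairs_perm π c e).1 hd, rfl⟩

lemma reducedLaw_perm (r : (Fin t → ℕ) → Fin t) (π : Equiv.Perm (Fin n)) (d : Clause 2 n) :
    reducedLaw k r n (Clause.perm π d) = reducedLaw k r n d := by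
  classical
  unfold reducedLaw
  refine (Finset.expect_equiv (Equiv.piCongrRight fun _ : Fin t => Clause.perm (k := k) π)
    (by simp) fun o _ => ?_).symm
  have h : keptClause r (Equiv.piCongrRight (fun _ : Fin t => Clause.perm (k := k) π) o) =
      Clause.perm π (keptClause r o) := by
    unfold keptClause
    simp only [Equiv.piCongrRight_apply, Pi.map_apply, Clause.numPos_perm]
  rw [h, card_mostPositivePairs_perm]
  exact if_congr (mem_mostPositivePairs_perm π _ d).symm rfl rfl

lemma Clause.numPos_of_eq_pair {d : Clause 2 n} {a b : Literal n} (h : d.1 = {a, b}) :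
    d.numPos = a.2.toNat + b.2.toNat := by
  have hne := Clause.fst_ne_of_eq_pair h
  have hab : a ≠ b := fun e => hne (by rw [e])
  unfold Clause.numPos
  rw [h, Finset.filter_insert, Finset.filter_singleton]
  cases ha : a.2 <;> cases hb : b.2 <;> simp [hab]

/-- A 2-clause with its positive literals listed first. -/
lemma Clause.exists_eq_pair (d : Clause 2 n) : ∃ x y : Fin n, x ≠ y ∧
    d.1 = {(x, decide (1 ≤ d.numPos)), (y, decide (2 ≤ d.numPos))} := by
  obtain ⟨a, b, -, h⟩ := Finset.card_eq_two.1 d.2.1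
  have hn := Clause.numPos_of_eq_pair h
  have hne := Clause.fst_ne_of_eq_pair h
  obtain ⟨x, s⟩ := a
  obtain ⟨y, s'⟩ := b
  simp only at hn hne
  rw [hn]
  cases s <;> cases s'
  · exact ⟨x, y, hne, by simp [h]⟩
  · exact ⟨y, x, hne.symm, by simp [h, Finset.pair_comm]⟩
  · exact ⟨x, y, hne, by simp [h]⟩
  · exact ⟨x, y, hne, by simp [h]⟩

lemma Clause.exists_perm_eq {d e : Clause 2 n} (h : d.numPos = e.numPos) :
    ∃ π, Clause.perm π d = e := by
  obtain ⟨x, y, hxy, hd⟩ := d.exists_eq_pair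
  obtain ⟨x', y', hxy', he⟩ := e.exists_eq_pair
  -- first move `x` to `x'`, then the image of `y` to `y'`, which fixes `x'`
  have hne : Equiv.swap x x' y ≠ x' := fun h' => hxy
    ((Equiv.swap x x').injective (by rw [h', Equiv.swap_apply_left]))
  refine ⟨(Equiv.swap x x').trans (Equiv.swap (Equiv.swap x x' y) y'), Subtype.ext ?_⟩
  change d.1.map (Literal.perm _).toEmbedding = e.1
  rw [hd, he, Finset.map_insert, Finset.map_singleton, h]
  congr 1
  · simp only [Equiv.coe_toEmbedding, Literal.perm, Equiv.prodCongr_apply, Prod.map_apply,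
      Equiv.trans_apply, Equiv.swap_apply_left, Equiv.refl_apply]
    rw [Equiv.swap_apply_of_ne_of_ne hne.symm hxy']
  · simp [Literal.perm]

/-- By symmetry, the law of the reduced clause depends on the number of positive literals only. -/
lemma reducedLaw_eq_div (hk : 2 ≤ k) (hkn : k ≤ n) (r : (Fin t → ℕ) → Fin t) (d : Clause 2 n) :
    reducedLaw k r n d =
      reducedSignProb k r n d.numPos / (n * (n - 1) / 2 * (Nat.choose 2 d.numPos : ℕ)) := by
  have h1 : ∀ e ∈ Finset.univ.filter (fun e : Clause 2 n => e.numPos = d.numPos),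
      reducedLaw k r n e = reducedLaw k r n d := fun e he => by
    obtain ⟨π, rfl⟩ := Clause.exists_perm_eq (Finset.mem_filter.1 he).2
    exact (reducedLaw_perm r π e).symm
  have hn : (2 : ℝ) ≤ n := by exact_mod_cast hk.trans hkn
  have hc : (0 : ℝ) < (Nat.choose 2 d.numPos : ℕ) := by
    exact_mod_cast Nat.choose_pos d.numPos_le
  rw [reducedSignProb_eq_sum hk, Finset.sum_congr rfl h1, Finset.sum_const,
    Clause.card_filter_numPos, nsmul_eq_mul, Nat.cast_mul, Nat.cast_choose_two,
    mul_div_cancel_left₀]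
  have : (0 : ℝ) < n * (n - 1) / 2 := by nlinarith
  positivity

/-- The law of the reduced clause as a function of an ordered pair of literals. -/
noncomputable def pairLaw (k : ℕ) (r : (Fin t → ℕ) → Fin t) (n : ℕ) (a b : Literal n) : ℝ :=
  ∑ d ∈ Finset.univ.filter (fun d : Clause 2 n => d.1 = {a, b}), reducedLaw k r n d

/-- The weight of a pair of signs: `p₁` if they differ, and `2 p₀` or `2 p₂` if they agree. -/
noncomputable def signWeight (k t : ℕ) : Bool → Bool → ℝ
  | false, false => 2 * pZero k t
  | true, true => 2 * pTwo k t
  | _, _ => pOne k t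

lemma pairLaw_nonneg (r : (Fin t → ℕ) → Fin t) (a b : Literal n) : 0 ≤ pairLaw k r n a b :=
  Finset.sum_nonneg fun d _ => reducedLaw_nonneg r d

lemma reducedLaw_eq_pairLaw (r : (Fin t → ℕ) → Fin t) {d : Clause 2 n} {a b : Literal n}
    (h : d.1 = {a, b}) : reducedLaw k r n d = pairLaw k r n a b := by
  have : (Finset.univ.filter fun e : Clause 2 n => e.1 = {a, b}) = {d} := by
    ext e
    simp only [Finset.mem_filter, Finset.mem_univ, true_and, Finset.mem_singleton]
    rw [← h, Subtype.ext_iff]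
  rw [pairLaw, this, Finset.sum_singleton]

lemma pairLaw_eq_zero (r : (Fin t → ℕ) → Fin t) {a b : Literal n} (h : a.1 = b.1) :
    pairLaw k r n a b = 0 := by
  rw [pairLaw, Finset.filter_false_of_mem fun d _ hd => Clause.fst_ne_of_eq_pair hd h,
    Finset.sum_empty]

lemma pairLaw_eq (hk : 2 ≤ k) (hkn : k ≤ n) {r : (Fin t → ℕ) → Fin t} (hr : IsMaxRule r)
    {a b : Literal n} (h : a.1 ≠ b.1) :
    pairLaw k r n a b = signWeight k t a.2 b.2 / (n * (n - 1)) := by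
  have hd : (Clause.pair a b h).1 = {a, b} := rfl
  have hn := Clause.numPos_of_eq_pair hd
  obtain ⟨h0, h1, h2⟩ := reducedSignProb_eq (n := n) hk hkn hr
  rw [← reducedLaw_eq_pairLaw r hd, reducedLaw_eq_div hk hkn, hn]
  cases a.2 <;> cases b.2 <;> simp only [Bool.toNat_false, Bool.toNat_true, signWeight, h0,
    add_zero, zero_add, Nat.reduceAdd, h1, h2, Nat.choose_self, Nat.choose_zero_right,
    Nat.choose_one_right] <;> push_cast <;> field_simp

end Symmetry

/-! ### Bicycles in unsatisfiable 2-SAT formulas -/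

section Walks

lemma exists_walk_of_reflTransGen {α : Type*} {R : α → α → Prop} {a b : α}
    (h : Relation.ReflTransGen R a b) :
    ∃ (N : ℕ) (f : ℕ → α), f 0 = a ∧ f N = b ∧ ∀ i < N, R (f i) (f (i + 1)) := by
  induction h using Relation.ReflTransGen.head_induction_on with
  | refl => exact ⟨0, fun _ => b, rfl, rfl, fun i hi => absurd hi (Nat.not_lt_zero i)⟩
  | @head a c hac _ ih =>
    obtain ⟨N, f, h0, hN, hf⟩ := ih
    refine ⟨N + 1, fun i => Nat.casesOn i a f, rfl, hN, fun i hi => ?_⟩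
    cases i with
    | zero => simpa [h0] using hac
    | succ i => exact hf i (by omega)

lemma reflTransGen_of_walk {α : Type*} {R : α → α → Prop} {f : ℕ → α} {N : ℕ}
    (hf : ∀ i < N, R (f i) (f (i + 1))) {s t : ℕ} (hst : s ≤ t) (ht : t ≤ N) :
    Relation.ReflTransGen R (f s) (f t) := by
  induction t, hst using Nat.le_induction with
  | base => exact .refl
  | succ t _ ih => exact (ih (by omega)).tail (hf t (by omega))

variable {n m : ℕ}

/-- An unsatisfiable 2-SAT formula has a literal that implies its negation and is implied by it:
otherwise a maximal consistent set of literals that is closed under implication gives a value to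
every variable. -/
lemma exists_contradictory_literal {F : Formula 2 n m} (h : ¬ Satisfiable F) :
    ∃ x : Literal n, Relation.ReflTransGen (Implies F) x x.neg ∧
      Relation.ReflTransGen (Implies F) x.neg x := by
  classical
  set P : Finset (Literal n) → Prop := fun A =>
    (∀ u ∈ A, ∀ w, Implies F u w → w ∈ A) ∧ ∀ l ∈ A, l.neg ∉ A with hP
  obtain ⟨A, hA, hmax⟩ := Finset.exists_max_image
    ((Finset.univ : Finset (Finset (Literal n))).filter P) Finset.card ⟨∅, by simp [hP]⟩
  obtain ⟨hcl, hcon⟩ := (Finset.mem_filter.1 hA).2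
  have hcl' : ∀ u ∈ A, ∀ w, Relation.ReflTransGen (Implies F) u w → w ∈ A := by
    intro u hu w hr
    induction hr with
    | refl => exact hu
    | tail _ h ih => exact hcl _ ih _ h
  have key : ∀ l : Literal n, l ∉ A → l.neg ∉ A →
      Relation.ReflTransGen (Implies F) l l.neg := by
    intro l hl hl'
    set A' := A ∪ Finset.univ.filter fun w => Relation.ReflTransGen (Implies F) l w with hA'
    have hlt : A.card < A'.card := by
      refine Finset.card_lt_card (Finset.ssubset_iff_of_subset Finset.subset_union_left |>.2
        ⟨l, Finset.mem_union_right _ (Finset.mem_filter.2 ⟨Finset.mem_univ _, .refl⟩), hl⟩)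
    have hnP : ¬ P A' := fun hPA =>
      absurd (hmax A' (Finset.mem_filter.2 ⟨Finset.mem_univ _, hPA⟩)) (not_le.2 hlt)
    have hcl2 : ∀ u ∈ A', ∀ w, Implies F u w → w ∈ A' := by
      intro u hu w huw
      rcases Finset.mem_union.1 hu with hu | hu
      · exact Finset.mem_union_left _ (hcl u hu w huw)
      · exact Finset.mem_union_right _ (Finset.mem_filter.2
          ⟨Finset.mem_univ _, (Finset.mem_filter.1 hu).2.tail huw⟩)
    -- by maximality of `A`, the larger closed set `A'` is inconsistent
    have : ∃ w ∈ A', w.neg ∈ A' := by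
      by_contra hno
      push Not at hno
      exact hnP ⟨hcl2, hno⟩
    obtain ⟨w, hw, hw'⟩ := this
    have hmix : ∀ w, w ∈ A → Relation.ReflTransGen (Implies F) l w.neg → False := by
      intro w hw hr
      have := reflTransGen_contrapose hr
      rw [Literal.neg_neg] at this
      exact hl' (hcl' w hw _ this)
    rcases Finset.mem_union.1 hw with hw | hw <;> rcases Finset.mem_union.1 hw' with hw' | hw'
    · exact absurd hw' (hcon w hw)
    · exact (hmix w hw (Finset.mem_filter.1 hw').2).elim
    · exact (hmix w.neg hw' (by simpa using hw)).elim
    · have h1 := (Finset.mem_filter.1 hw).2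
      have h2 := reflTransGen_contrapose (Finset.mem_filter.1 hw').2
      rw [Literal.neg_neg] at h2
      exact h1.trans h2
  by_cases hall : ∀ l : Literal n, l ∈ A ∨ l.neg ∈ A
  · refine (h ⟨fun v => decide ((v, true) ∈ A), fun i => ?_⟩).elim
    have htrue : ∀ l : Literal n, l ∈ A → decide ((l.1, true) ∈ A) = l.2 := by
      rintro ⟨v, b⟩ hl
      cases b
      · exact decide_eq_false fun h => hcon _ h hl
      · exact decide_eq_true hl
    obtain ⟨a, b, -, hab⟩ := Finset.card_eq_two.1 (F i).2.1
    rcases hall a with ha | ha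
    · exact ⟨a, by rw [hab]; simp, htrue a ha⟩
    · exact ⟨b, by rw [hab]; simp, htrue b (hcl _ ha b ⟨i, by rw [hab, Literal.neg_neg]⟩)⟩
  · push Not at hall
    obtain ⟨l, hl, hl'⟩ := hall
    refine ⟨l, key l hl hl', ?_⟩
    have := key l.neg hl' (by rwa [Literal.neg_neg])
    rwa [Literal.neg_neg] at this

/-- A bicycle of `F`: a walk `w 0 ⟶ ⋯ ⟶ w r` on distinct variables in the implication digraph,
entered from the complement of one of its literals, and left for a literal `v` on one of its
variables. -/
def IsBicycle {r : ℕ} (F : Formula 2 n m) (w : Fin (r + 1) → Literal n) (p : Fin (r + 1))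
    (v : Literal n) : Prop :=
  (Function.Injective fun l => (w l).1) ∧ Implies F (w p).neg (w 0) ∧
    (∀ l : Fin r, Implies F (w l.castSucc) (w l.succ)) ∧ Implies F (w (Fin.last r)) v ∧
    ∃ j, v.1 = (w j).1

/-- A shortest walk from a literal to its complement, over all literals that are equivalent to their
complements, has distinct variables.  Continued back to its starting point, it gives a bicycle when
a variable is repeated for the first time. -/
lemma exists_isBicycle {F : Formula 2 n m} (h : ¬ Satisfiable F) :
    ∃ (r : ℕ) (w : Fin (r + 1) → Literal n) (p : Fin (r + 1)) (v : Literal n),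
      IsBicycle F w p v := by
  classical
  have hex : ∃ N, ∃ a : ℕ → Literal n, (∀ i < N, Implies F (a i) (a (i + 1))) ∧
      a N = (a 0).neg ∧ Relation.ReflTransGen (Implies F) (a 0).neg (a 0) := by
    obtain ⟨x, h1, h2⟩ := exists_contradictory_literal h
    obtain ⟨N, a, h0, hN, ha⟩ := exists_walk_of_reflTransGen h1
    exact ⟨N, a, ha, by rw [hN, h0], by rw [h0]; exact h2⟩
  obtain ⟨a, ha, hap, hback⟩ := Nat.find_spec hex
  have hmin : ∀ N < Nat.find hex, _ := fun N hN => Nat.find_min hex hN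
  set p := Nat.find hex with hp
  have hp1 : 1 ≤ p := by
    by_contra hlt
    have : p = 0 := by omega
    rw [this] at hap
    exact (a 0).neg_ne hap.symm
  -- A repeated literal allows a shortcut.  A complementary pair `a t = ¬ a s` gives a shorter walk
  -- from a literal to its complement.
  have hinj : ∀ s t, 1 ≤ s → s < t → t ≤ p → (a s).1 ≠ (a t).1 := by
    intro s t hs hst htp he
    rcases Literal.eq_or_eq_neg he.symm with he | he
    · refine hmin (p - (t - s)) (by omega) ⟨fun i => if i ≤ s then a i else a (i + (t - s)),
        fun i hi => ?_, ?_, ?_⟩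
      · rcases lt_trichotomy i s with h1 | h1 | h1
        · simp only [h1.le, if_true, Nat.succ_le_of_lt h1]
          exact ha i (by omega)
        · subst h1
          simp only [le_refl, if_true, show ¬ i + 1 ≤ i by omega, if_false]
          rw [← he, show i + 1 + (t - i) = t + 1 by omega]
          exact ha t (by omega)
        · simp only [show ¬ i ≤ s by omega, if_false, show ¬ i + 1 ≤ s by omega]
          rw [show i + 1 + (t - s) = i + (t - s) + 1 by omega]
          exact ha _ (by omega)
      · simp only [Nat.zero_le, if_true]
        rw [← hap]
        split_ifs with h1
        · have h2 : t = p := by omega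
          rw [show p - (t - s) = s by omega, ← he, h2]
        · rw [Nat.sub_add_cancel (by omega)]
      · simpa using hback
    · refine hmin (t - s) (by omega) ⟨fun i => a (s + i), fun i hi => ha (s + i) (by omega), ?_, ?_⟩
      · simp only [add_zero]
        rw [Nat.add_sub_cancel' hst.le, he]
      · simp only [add_zero]
        rw [← he]
        have h1 := reflTransGen_of_walk ha htp le_rfl
        rw [hap] at h1
        exact (h1.trans hback).trans (reflTransGen_of_walk ha (Nat.zero_le s) (by omega))
  -- append a walk `b` from `¬ a 0` back to `a 0`, and stop at the first repeated variable
  obtain ⟨M, b, hb0, hbM, hb⟩ := exists_walk_of_reflTransGen hback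
  have hM1 : 1 ≤ M := by
    by_contra hlt
    have : M = 0 := by omega
    rw [this, hb0] at hbM
    exact (a 0).neg_ne hbM
  set A : ℕ → Literal n := fun i => if i ≤ p then a i else b (i - p) with hA
  have hAa : ∀ i ≤ p, A i = a i := fun i hi => if_pos hi
  have hAb : ∀ i, p ≤ i → A i = b (i - p) := by
    intro i hi
    rcases hi.eq_or_lt with rfl | hi
    · rw [hAa _ le_rfl, Nat.sub_self, hb0, hap]
    · exact if_neg (by omega)
  have hAw : ∀ i < p + M, Implies F (A i) (A (i + 1)) := by
    intro i hi
    rcases lt_or_ge i p with h1 | h1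
    · rw [hAa i h1.le, hAa (i + 1) h1]
      exact ha i h1
    · rw [hAb i h1, hAb (i + 1) (by omega), show i + 1 - p = i - p + 1 by omega]
      exact hb _ (by omega)
  have hext : ∃ t, p < t ∧ t ≤ p + M ∧ ∃ i, 1 ≤ i ∧ i < t ∧ (A t).1 = (A i).1 := by
    refine ⟨p + M, by omega, le_rfl, p, hp1, by omega, ?_⟩
    rw [hAb (p + M) (by omega), Nat.add_sub_cancel_left, hbM, hAa p le_rfl, hap, Literal.neg_fst]
  obtain ⟨hpt, htM, i, hi1, hit, hAi⟩ := Nat.find_spec hext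
  have htmin : ∀ s < Nat.find hext, _ := fun s hs => Nat.find_min hext hs
  set t := Nat.find hext with ht
  have hAinj : ∀ s s', 1 ≤ s → s < s' → s' < t → (A s).1 ≠ (A s').1 := by
    intro s s' hs hss hst he
    rcases le_or_gt s' p with h1 | h1
    · rw [hAa s (by omega), hAa s' h1] at he
      exact hinj s s' hs hss h1 he
    · exact htmin s' hst ⟨h1, by omega, s, hs, hss, he.symm⟩
  refine ⟨t - 2, fun l => A (l + 1), ⟨p - 1, by omega⟩, A t, ?_, ?_, ?_, ?_, ⟨i - 1, by omega⟩, ?_⟩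
  · intro l l' hl
    simp only at hl
    apply Fin.ext
    rcases lt_trichotomy l.1 l'.1 with h1 | h1 | h1
    · exact absurd hl (hAinj _ _ (by omega) (by omega) (by omega))
    · exact h1
    · exact absurd hl.symm (hAinj _ _ (by omega) (by omega) (by omega))
  · have h1 := hAw 0 (by omega)
    simp only [Nat.sub_add_cancel hp1, Fin.val_zero]
    rw [hAa p le_rfl, hap, Literal.neg_neg, ← hAa 0 (by omega)]
    exact h1
  · intro l
    exact hAw (l + 1) (by omega)
  · have h1 := hAw (t - 1) (by omega)
    simp only [Fin.val_last]
    rw [show t - 2 + 1 = t - 1 by omega]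
    rwa [Nat.sub_add_cancel (by omega)] at h1
  · simp only [Nat.sub_add_cancel hi1]
    exact hAi

end Walks

/-! ### The expected number of bicycles -/

section FirstMoment

variable {k n t m : ℕ}

/-- The end points of the arcs of the walk `w 0 ⟶ ⋯ ⟶ w r ⟶ v`. -/
def arcEnd {r : ℕ} (w : Fin (r + 1) → Literal n) (v : Literal n) (l : Fin (r + 1)) : Literal n :=
  Fin.snoc (α := fun _ => Literal n) (fun i : Fin r => w i.succ) v l

/-- The boxes of clauses that must be hit for a bicycle: `none` for the entering arc, and `some l`
for the arc that leaves `w l`. -/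
def bicycleBox {r : ℕ} (w : Fin (r + 1) → Literal n) (p : Fin (r + 1)) (v : Literal n) :
    Option (Fin (r + 1)) → Finset (Clause 2 n)
  | none => Finset.univ.filter fun c => c.1 = {w p, w 0}
  | some l => Finset.univ.filter fun c => c.1 = {(w l).neg, arcEnd w v l}

lemma arcEnd_castSucc {r : ℕ} (w : Fin (r + 1) → Literal n) (v : Literal n) (l : Fin r) :
    arcEnd w v l.castSucc = w l.succ := by
  simp [arcEnd]

lemma arcEnd_last {r : ℕ} (w : Fin (r + 1) → Literal n) (v : Literal n) :
    arcEnd w v (Fin.last r) = v := by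
  simp [arcEnd]

/-- The clauses of a bicycle are distinct, as the clause of the arc leaving `w l` is the only one
that contains the complement of `w l` on the walk. -/
lemma pairwiseDisjoint_bicycleBox {r : ℕ} {w : Fin (r + 1) → Literal n}
    (hw : Function.Injective fun l => (w l).1) (p : Fin (r + 1)) (v : Literal n)
    (s : Set (Option (Fin (r + 1)))) : s.PairwiseDisjoint (bicycleBox w p v) := by
  have hneg : ∀ l l', (w l).neg ≠ w l' := fun l l' h => by
    have hfst : (w l).1 = (w l').1 := by rw [← Literal.neg_fst (w l), h]
    obtain rfl : l = l' := hw hfst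
    exact (w l).neg_ne h
  have h1 : ∀ l, Disjoint (bicycleBox w p v none) (bicycleBox w p v (some l)) := by
    intro l
    refine Finset.disjoint_left.2 fun c hc hc' => ?_
    have e := (Finset.mem_filter.1 hc).2
    have e' := (Finset.mem_filter.1 hc').2
    have : (w l).neg ∈ c.1 := by rw [e']; simp
    rw [e, Finset.mem_insert, Finset.mem_singleton] at this
    rcases this with h | h
    · exact hneg _ _ h
    · exact hneg _ _ h
  have h2 : ∀ l l', l < l' → Disjoint (bicycleBox w p v (some l)) (bicycleBox w p v (some l')) := by
    intro l l' hll
    refine Finset.disjoint_left.2 fun c hc hc' => ?_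
    have e := (Finset.mem_filter.1 hc).2
    have e' := (Finset.mem_filter.1 hc').2
    have : (w l').neg ∈ c.1 := by rw [e']; simp
    rw [e, Finset.mem_insert, Finset.mem_singleton] at this
    rcases this with h | h
    · have hfst : (w l').1 = (w l).1 := by
        rw [← Literal.neg_fst (w l'), h, Literal.neg_fst]
      exact hll.ne' (hw hfst)
    · obtain ⟨i, rfl⟩ := Fin.exists_castSucc_eq.2 (ne_of_lt (hll.trans_le (Fin.le_last l')))
      rw [arcEnd_castSucc] at h
      exact hneg _ _ h
  intro a _ b _ hab
  rcases a with _ | l <;> rcases b with _ | l'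
  · exact absurd rfl hab
  · exact h1 l'
  · exact (h1 l).symm
  · rcases lt_trichotomy l l' with h | h | h
    · exact h2 l l' h
    · exact absurd (congrArg some h) hab
    · exact (h2 l' l h).symm

/-- The clauses of a given bicycle are distinct, hence the product bound. -/
lemma iidProb_isBicycle_le (hk : 2 ≤ k) (hkn : k ≤ n) {r : (Fin t → ℕ) → Fin t}
    (hr : IsMaxRule r) {s : ℕ} (w : Fin (s + 1) → Literal n) (p : Fin (s + 1)) (v : Literal n) :
    iidProb (reducedLaw k r n) m (fun F => IsBicycle F w p v) ≤
      (m * pairLaw k r n (w p) (w 0)) *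
        ((∏ l : Fin s, m * pairLaw k r n (w l.castSucc).neg (w l.succ)) *
          (m * pairLaw k r n (w (Fin.last s)).neg v)) := by
  classical
  have hq := reducedLaw_nonneg (k := k) (n := n) r
  have hq1 := sum_reducedLaw hk hkn hr
  have hpl := pairLaw_nonneg (k := k) (n := n) r
  by_cases hw : Function.Injective fun l => (w l).1
  · have hb1 : ∀ z, ∑ c ∈ bicycleBox w p v z, reducedLaw k r n c ≤ 1 := fun z =>
      hq1 ▸ Finset.sum_le_univ_sum_of_nonneg hq
    have hb0 : ∀ z, 0 ≤ ∑ c ∈ bicycleBox w p v z, reducedLaw k r n c := fun z =>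
      Finset.sum_nonneg fun c _ => hq c
    calc _ ≤ iidProb (reducedLaw k r n) m
          (fun F => ∀ z ∈ Finset.univ, ∃ i, F i ∈ bicycleBox w p v z) := by
          refine iidProb_mono hq fun F hF z _ => ?_
          obtain ⟨-, ⟨i, hi⟩, h2, ⟨i', hi'⟩, -⟩ := hF
          rcases z with _ | l
          · rw [Literal.neg_neg] at hi
            exact ⟨i, Finset.mem_filter.2 ⟨Finset.mem_univ _, hi⟩⟩
          · rcases Fin.eq_castSucc_or_eq_last l with ⟨l, rfl⟩ | rfl
            · obtain ⟨j, hj⟩ := h2 l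
              exact ⟨j, Finset.mem_filter.2 ⟨Finset.mem_univ _, by rw [hj, arcEnd_castSucc]⟩⟩
            · exact ⟨i', Finset.mem_filter.2 ⟨Finset.mem_univ _, by rw [hi', arcEnd_last]⟩⟩
      _ ≤ ∏ z, (1 - (1 - ∑ c ∈ bicycleBox w p v z, reducedLaw k r n c) ^ m) :=
          iidProb_forall_hit_le hq hq1 _ _ (pairwiseDisjoint_bicycleBox hw p v _) m
      _ ≤ ∏ z, m * ∑ c ∈ bicycleBox w p v z, reducedLaw k r n c :=
          Finset.prod_le_prod (fun z _ => sub_nonneg.2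
            (pow_le_one₀ (by linarith [hb1 z]) (by linarith [hb0 z])))
            fun z _ => one_sub_one_sub_pow_le (hb1 z) m
      _ = _ := by
          rw [Fintype.prod_option, Fin.prod_univ_castSucc]
          simp only [bicycleBox, arcEnd_castSucc, arcEnd_last, pairLaw]
  · have : iidProb (reducedLaw k r n) m (fun F => IsBicycle F w p v) = 0 :=
      Finset.sum_eq_zero fun F _ => if_neg fun h => hw h.1
    rw [this]
    exact mul_nonneg (mul_nonneg (by positivity) (hpl _ _))
      (mul_nonneg (Finset.prod_nonneg fun l _ => mul_nonneg (by positivity) (hpl _ _))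
        (mul_nonneg (by positivity) (hpl _ _)))

lemma pZero_pos (k t : ℕ) : 0 < pZero k t := by unfold pZero; positivity

lemma pOne_nonneg (k t : ℕ) : 0 ≤ pOne k t := by
  unfold pOne pZero
  rw [pow_mul, ← one_div_pow, sub_nonneg]
  refine pow_le_pow_left₀ (by positivity) ?_ t
  exact div_le_div_of_nonneg_right (by linarith [(Nat.cast_nonneg k : (0 : ℝ) ≤ k)]) (by positivity)

lemma pZero_add_pOne_add_pTwo (k t : ℕ) : pZero k t + pOne k t + pTwo k t = 1 := by
  unfold pTwo; ring

/-- An eigenvector of the matrix of expected numbers of successors of a literal, by signs (`true` for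
positive literals). -/
noncomputable def signVector (k t : ℕ) (b : Bool) : ℝ :=
  if b then √(pZero k t) else √(pTwo k t)

lemma sum_pairLaw_mul_signVector (hk : 2 ≤ k) (hkn : k ≤ n) {r : (Fin t → ℕ) → Fin t}
    (hr : IsMaxRule r) (hp2 : 0 ≤ pTwo k t) (u : Literal n) :
    ∑ v, pairLaw k r n u.neg v * signVector k t v.2 =
      (pOne k t + 2 * √(pZero k t * pTwo k t)) / n * signVector k t u.2 := by
  classical
  have hn : (2 : ℝ) ≤ n := by exact_mod_cast hk.trans hkn
  have h1 : ∀ x : Fin n, ∑ b : Bool, pairLaw k r n u.neg (x, b) * signVector k t b =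
      if x = u.1 then 0
        else ∑ b : Bool, signWeight k t (!u.2) b / (n * (n - 1)) * signVector k t b := by
    intro x
    split_ifs with hx
    · refine Finset.sum_eq_zero fun b _ => ?_
      rw [pairLaw_eq_zero r (a := u.neg) (b := (x, b)) hx.symm, zero_mul]
    · refine Finset.sum_congr rfl fun b _ => ?_
      rw [pairLaw_eq hk hkn hr (a := u.neg) (b := (x, b)) (fun h => hx h.symm)]
      rfl
  have hcard : ((Finset.univ.filter fun x : Fin n => ¬ x = u.1).card : ℝ) = n - 1 := by
    rw [Finset.filter_not, Finset.filter_eq', if_pos (Finset.mem_univ _),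
      Finset.card_sdiff_of_subset (Finset.subset_univ _), Finset.card_univ, Fintype.card_fin,
      Finset.card_singleton, Nat.cast_sub (by omega), Nat.cast_one]
  rw [Fintype.sum_prod_type]
  simp only [h1]
  rw [Finset.sum_ite, Finset.sum_const_zero, zero_add, Finset.sum_const, nsmul_eq_mul, hcard,
    Real.sqrt_mul (pZero_pos k t).le]
  have e0 : √(pZero k t) * √(pZero k t) = pZero k t := Real.mul_self_sqrt (pZero_pos k t).le
  have e2 : √(pTwo k t) * √(pTwo k t) = pTwo k t := Real.mul_self_sqrt hp2
  have hn0 : (n : ℝ) ≠ 0 := by linarith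
  have hn1 : (n : ℝ) - 1 ≠ 0 := by linarith
  cases u.2
  · simp only [Fintype.sum_bool, signWeight, signVector, Bool.not_false, Bool.false_eq_true,
      if_true, if_false]
    field_simp
    linear_combination (-2 * √(pZero k t)) * e2
  · simp only [Fintype.sum_bool, signWeight, signVector, Bool.not_true, Bool.false_eq_true,
      if_true, if_false]
    field_simp
    linear_combination (-2 * √(pTwo k t)) * e0

/-- The weighted number of walks grows at most like `lam ^ s` if `h` is a positive vector with
`A h ≤ lam * h`. -/
lemma sum_prod_mul_le {V : Type*} [Fintype V] {A : V → V → ℝ} {h : V → ℝ} {lam : ℝ}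
    (hA : ∀ u v, 0 ≤ A u v) (hAh : ∀ u, ∑ v, A u v * h v ≤ lam * h u) (hlam : 0 ≤ lam) (s : ℕ) :
    ∑ w : Fin (s + 1) → V, (∏ l : Fin s, A (w l.castSucc) (w l.succ)) * h (w (Fin.last s)) ≤
      lam ^ s * ∑ u, h u := by
  induction s with
  | zero =>
    rw [pow_zero, one_mul, ← (Equiv.funUnique (Fin 1) V).symm.sum_comp]
    simp
  | succ s ih =>
    rw [← (Fin.snocEquiv (fun _ : Fin (s + 2) => V)).sum_comp, Fintype.sum_prod_type_right]
    calc _ = ∑ w : Fin (s + 1) → V, (∏ l : Fin s, A (w l.castSucc) (w l.succ)) *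
            ∑ v, A (w (Fin.last s)) v * h v := by
          refine Finset.sum_congr rfl fun w _ => ?_
          rw [Finset.mul_sum]
          refine Finset.sum_congr rfl fun v _ => ?_
          rw [Fin.prod_univ_castSucc]
          simp only [Fin.snocEquiv, Equiv.coe_fn_mk, Fin.snoc_castSucc, Fin.snoc_last,
            Fin.succ_castSucc, Fin.succ_last, mul_assoc]
      _ ≤ ∑ w : Fin (s + 1) → V, (∏ l : Fin s, A (w l.castSucc) (w l.succ)) *
            (lam * h (w (Fin.last s))) :=
          Finset.sum_le_sum fun w _ => mul_le_mul_of_nonneg_left (hAh _)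
            (Finset.prod_nonneg fun l _ => hA _ _)
      _ = lam * ∑ w : Fin (s + 1) → V, (∏ l : Fin s, A (w l.castSucc) (w l.succ)) *
            h (w (Fin.last s)) := by
          rw [Finset.mul_sum]
          exact Finset.sum_congr rfl fun w _ => by ring
      _ ≤ lam * (lam ^ s * ∑ u, h u) := mul_le_mul_of_nonneg_left ih hlam
      _ = _ := by ring

end FirstMoment

/-! ### Satisfiability below the critical density -/

section Satisfiable

variable {k n t m : ℕ}

lemma pairLaw_le (hk : 2 ≤ k) (hkn : k ≤ n) {r : (Fin t → ℕ) → Fin t} (hr : IsMaxRule r)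
    (hp2 : 0 ≤ pTwo k t) (a b : Literal n) : pairLaw k r n a b ≤ 2 / (n * (n - 1)) := by
  have hn : (2 : ℝ) ≤ n := by exact_mod_cast hk.trans hkn
  have hN : (0 : ℝ) < n * (n - 1) := by nlinarith
  by_cases h : a.1 = b.1
  · rw [pairLaw_eq_zero r h]; positivity
  · rw [pairLaw_eq hk hkn hr h]
    refine div_le_div_of_nonneg_right ?_ hN.le
    have h0 := (pZero_pos k t).le
    have h1 := pOne_nonneg k t
    have hs := pZero_add_pOne_add_pTwo k t
    cases a.2 <;> cases b.2 <;> simp only [signWeight] <;> linarith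

/-- The expected number of bicycles on `s + 1` variables. -/
lemma iidProb_exists_isBicycle_le (hk : 2 ≤ k) (hkn : k ≤ n) {r : (Fin t → ℕ) → Fin t}
    (hr : IsMaxRule r) (hp2 : 0 < pTwo k t) {a : ℝ} (hm : m ≤ a * n) (s : ℕ) :
    iidProb (reducedLaw k r n) m (fun F => ∃ (w : Fin (s + 1) → Literal n) (p : Fin (s + 1))
        (v : Literal n), IsBicycle F w p v) ≤
      2 * (s + 1) ^ 2 * (m * (2 / (n * (n - 1)))) ^ 2 *
        ((a * (pOne k t + 2 * √(pZero k t * pTwo k t))) ^ s *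
          (2 * n / min √(pZero k t) √(pTwo k t))) := by
  classical
  have hq := reducedLaw_nonneg (k := k) (n := n) r
  have hpl := pairLaw_nonneg (k := k) (n := n) r
  have hple := pairLaw_le (n := n) hk hkn hr hp2.le
  have hn : (2 : ℝ) ≤ n := by exact_mod_cast hk.trans hkn
  have h0 := pZero_pos k t
  have h1 := pOne_nonneg k t
  have hs := pZero_add_pOne_add_pTwo k t
  set μ : ℝ := pOne k t + 2 * √(pZero k t * pTwo k t) with hμ
  have hμ0 : 0 ≤ μ := by positivity
  have ha : 0 ≤ a := by
    by_contra hlt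
    have : a * n < 0 := mul_neg_of_neg_of_pos (not_le.1 hlt) (by linarith)
    linarith [(Nat.cast_nonneg m : (0 : ℝ) ≤ m)]
  set ε : ℝ := m * (2 / (n * (n - 1))) with hε
  have hN : (0 : ℝ) < n * (n - 1) := by nlinarith
  have hε0 : 0 ≤ ε := by positivity
  have hplε : ∀ x y, m * pairLaw k r n x y ≤ ε := fun x y =>
    mul_le_mul_of_nonneg_left (hple x y) (by positivity)
  have hplm : ∀ x y, 0 ≤ m * pairLaw k r n x y := fun x y => mul_nonneg (by positivity) (hpl x y)
  set hmin : ℝ := min √(pZero k t) √(pTwo k t) with hhmin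
  have hmin0 : 0 < hmin := lt_min (Real.sqrt_pos.2 h0) (Real.sqrt_pos.2 hp2)
  set W : (Fin (s + 1) → Literal n) → ℝ := fun w =>
    ∏ l : Fin s, m * pairLaw k r n (w l.castSucc).neg (w l.succ) with hW
  have hW0 : ∀ w, 0 ≤ W w := fun w => Finset.prod_nonneg fun l _ => hplm _ _
  have hWsum : ∑ w, W w ≤ (a * μ) ^ s * (2 * n / hmin) := by
    have hvmin : ∀ b, hmin ≤ signVector k t b := fun b => by
      cases b
      · exact min_le_right _ _
      · exact min_le_left _ _
    have hvmax : ∀ b, signVector k t b ≤ 1 := fun b => by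
      cases b
      · exact Real.sqrt_le_one.2 (by linarith)
      · exact Real.sqrt_le_one.2 (by linarith)
    have h2 := sum_prod_mul_le (A := fun u v : Literal n => m * pairLaw k r n u.neg v)
      (h := fun u => signVector k t u.2) (lam := a * μ) (fun u v => hplm _ _) (fun u => by
        simp only [mul_assoc]
        rw [← Finset.mul_sum, sum_pairLaw_mul_signVector hk hkn hr hp2.le, ← hμ]
        have h3 : (m : ℝ) / n ≤ a := (div_le_iff₀ (by linarith)).2 hm
        have h4 : 0 ≤ μ * signVector k t u.2 := mul_nonneg hμ0 (hmin0.le.trans (hvmin _))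
        calc (m : ℝ) * (μ / n * signVector k t u.2) = m / n * (μ * signVector k t u.2) := by ring
          _ ≤ a * (μ * signVector k t u.2) := mul_le_mul_of_nonneg_right h3 h4) (by positivity) s
    have h5 : hmin * ∑ w, W w ≤ (a * μ) ^ s * ∑ u : Literal n, signVector k t u.2 := by
      refine le_trans ?_ h2
      rw [Finset.mul_sum]
      refine Finset.sum_le_sum fun w _ => ?_
      rw [mul_comm]
      exact mul_le_mul_of_nonneg_left (hvmin _) (hW0 w)
    have h6 : ∑ u : Literal n, signVector k t u.2 ≤ 2 * n := by
      refine (Finset.sum_le_sum fun u _ => hvmax u.2).trans ?_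
      simp [mul_comm]
    rw [← mul_div_assoc, le_div_iff₀ hmin0, mul_comm]
    exact h5.trans (mul_le_mul_of_nonneg_left h6 (by positivity))
  -- `x` consists of the walk, the position of the entering arc, and the position and the sign of `v`
  calc _ ≤ iidProb (reducedLaw k r n) m (fun F =>
          ∃ x ∈ (Finset.univ : Finset ((Fin (s + 1) → Literal n) × Fin (s + 1) × Fin (s + 1) × Bool)),
            IsBicycle F x.1 x.2.1 ((x.1 x.2.2.1).1, x.2.2.2)) := by
        refine iidProb_mono hq fun F hF => ?_
        obtain ⟨w, p, v, hb⟩ := hF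
        obtain ⟨j, hj⟩ := hb.2.2.2.2
        exact ⟨(w, p, j, v.2), Finset.mem_univ _, by simp only [← hj]; exact hb⟩
    _ ≤ ∑ x : (Fin (s + 1) → Literal n) × Fin (s + 1) × Fin (s + 1) × Bool, ε * (W x.1 * ε) := by
        refine (iidProb_exists_le hq _ _).trans (Finset.sum_le_sum fun x _ => ?_)
        refine (iidProb_isBicycle_le hk hkn hr x.1 x.2.1 _).trans ?_
        exact mul_le_mul (hplε _ _) (mul_le_mul_of_nonneg_left (hplε _ _) (hW0 _))
          (mul_nonneg (hW0 _) (hplm _ _)) hε0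
    _ = 2 * (s + 1) ^ 2 * ε ^ 2 * ∑ w, W w := by
        rw [Fintype.sum_prod_type, Finset.mul_sum]
        refine Finset.sum_congr rfl fun w _ => ?_
        simp only [Finset.sum_const, Finset.card_univ, Fintype.card_prod, Fintype.card_fin,
          Fintype.card_bool, nsmul_eq_mul]
        push_cast
        ring
    _ ≤ _ := mul_le_mul_of_nonneg_left hWsum (by positivity)

/-- Below `alphaStar` the reduced formula is satisfiable with high probability: a bicycle on `s + 1`
variables exists with probability `O ((s + 1) ^ 2 * lam ^ s / n)`, where `lam < 1`. -/
lemma tendsto_reducedSatProb (hk : 2 ≤ k) {r : (Fin t → ℕ) → Fin t} (hr : IsMaxRule r)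
    (hp2 : 0 < pTwo k t) {α : ℝ} (hα : α < alphaStar k t) :
    Tendsto (fun n : ℕ => (mostPositiveStrategy k r n).reducedSatProb ⌊α * n⌋₊) atTop (𝓝 1) := by
  set μ : ℝ := pOne k t + 2 * √(pZero k t * pTwo k t) with hμ
  have h1 := pOne_nonneg k t
  have hμ0 : 0 < μ := by
    have := Real.sqrt_pos.2 (mul_pos (pZero_pos k t) hp2)
    linarith
  have hstar : alphaStar k t = 1 / μ := rfl
  set a : ℝ := max α 0 with ha
  have ha0 : 0 ≤ a := le_max_right _ _
  have haμ : a * μ < 1 := by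
    rw [← lt_div_iff₀ hμ0, ← hstar]
    exact max_lt hα (by rw [hstar]; positivity)
  set lam := a * μ with hlam
  have hlam0 : 0 ≤ lam := by positivity
  set hmin : ℝ := min √(pZero k t) √(pTwo k t) with hhmin
  have hmin0 : 0 < hmin := lt_min (Real.sqrt_pos.2 (pZero_pos k t)) (Real.sqrt_pos.2 hp2)
  have hsummable : Summable fun s : ℕ => ((s : ℝ) + 1) ^ 2 * lam ^ s := by
    have e : ∀ s : ℕ, ((s : ℝ) + 1) ^ 2 * lam ^ s =
        (s : ℝ) ^ 2 * lam ^ s + 2 * ((s : ℝ) ^ 1 * lam ^ s) + lam ^ s := fun s => by ring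
    simp only [e]
    have hl : ‖lam‖ < 1 := by rwa [Real.norm_of_nonneg hlam0]
    exact ((summable_pow_mul_geometric_of_norm_lt_one 2 hl).add
      ((summable_pow_mul_geometric_of_norm_lt_one 1 hl).mul_left 2)).add
      (summable_geometric_of_lt_one hlam0 haμ)
  set K : ℝ := ∑' s : ℕ, ((s : ℝ) + 1) ^ 2 * lam ^ s with hK
  have hlower : ∀ᶠ n : ℕ in atTop, 1 - 64 * a ^ 2 / hmin * K * (1 / (n : ℝ)) ≤
      (mostPositiveStrategy k r n).reducedSatProb ⌊α * n⌋₊ := by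
    filter_upwards [eventually_ge_atTop k] with n hkn
    have hn : (2 : ℝ) ≤ n := by exact_mod_cast hk.trans hkn
    have hq := reducedLaw_nonneg (k := k) (n := n) r
    set m := ⌊α * n⌋₊ with hm
    have hma : (m : ℝ) ≤ a * n := by
      refine le_trans (Nat.cast_le.2 (Nat.floor_le_floor (b := a * n) ?_)) (Nat.floor_le (by positivity))
      exact mul_le_mul_of_nonneg_right (le_max_left _ _) (by positivity)
    have hN : (0 : ℝ) < n * (n - 1) := by nlinarith
    have hε : (m * (2 / (n * (n - 1))) : ℝ) ≤ 4 * a / n := by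
      rw [← mul_div_assoc, div_le_div_iff₀ hN (by linarith)]
      have h2 : (m : ℝ) * 2 * n ≤ a * n * 2 * n := by gcongr
      have h3 : 0 ≤ a * n * (2 * (n - 2)) :=
        mul_nonneg (by positivity) (by linarith)
      nlinarith
    have hε0 : (0 : ℝ) ≤ m * (2 / (n * (n - 1))) := by positivity
    have hsplit := iidProb_add_iidProb_not (q := reducedLaw k r n) (m := m)
      (Satisfiable (k := 2))
    rw [sum_reducedLaw hk hkn hr, one_pow, ← reducedSatProb_eq_iidProb] at hsplit
    have hunsat : iidProb (reducedLaw k r n) m (fun F => ¬ Satisfiable (k := 2) F) ≤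
        64 * a ^ 2 / hmin * K * (1 / (n : ℝ)) := by
      calc _ ≤ iidProb (reducedLaw k r n) m (fun F => ∃ s ∈ Finset.range n,
            ∃ (w : Fin (s + 1) → Literal n) (p : Fin (s + 1)) (v : Literal n),
              IsBicycle F w p v) := by
            refine iidProb_mono hq fun F hF => ?_
            obtain ⟨s, w, p, v, hb⟩ := exists_isBicycle hF
            refine ⟨s, ?_, w, p, v, hb⟩
            have := Fintype.card_le_of_injective _ hb.1
            simp only [Fintype.card_fin] at this
            exact Finset.mem_range.2 this
        _ ≤ ∑ s ∈ Finset.range n, 64 * a ^ 2 / hmin * (1 / (n : ℝ)) *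
              (((s : ℝ) + 1) ^ 2 * lam ^ s) := by
            refine (iidProb_exists_le hq _ _).trans (Finset.sum_le_sum fun s _ => ?_)
            refine (iidProb_exists_isBicycle_le hk hkn hr hp2 hma s).trans ?_
            rw [← hμ, ← hlam, ← hhmin]
            calc _ ≤ 2 * ((s : ℝ) + 1) ^ 2 * (4 * a / n) ^ 2 * (lam ^ s * (2 * n / hmin)) := by
                  gcongr
              _ = _ := by field_simp; ring
        _ ≤ 64 * a ^ 2 / hmin * (1 / (n : ℝ)) * K := by
            rw [← Finset.mul_sum]
            exact mul_le_mul_of_nonneg_left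
              (hsummable.sum_le_tsum _ fun s _ => by positivity) (by positivity)
        _ = _ := by ring
    linarith
  have hupper : ∀ᶠ n : ℕ in atTop,
      (mostPositiveStrategy k r n).reducedSatProb ⌊α * n⌋₊ ≤ 1 :=
    Eventually.of_forall fun n => (reducedSatProb_le_satProb _ _).trans (satProb_le_one _ _)
  refine tendsto_of_tendsto_of_tendsto_of_le_of_le' ?_ tendsto_const_nhds hlower hupper
  have := (tendsto_one_div_atTop_nhds_zero_nat (𝕜 := ℝ)).const_mul (64 * a ^ 2 / hmin * K)
  simpa using this.const_sub 1

end Satisfiable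

/-! ### Numerical values and unsatisfiable densities -/

lemma pTwo_three_pos {k : ℕ} (hk : 2 ≤ k) : 0 < pTwo k 3 := by
  have h : ((k : ℝ) + 1) / 2 ^ k < 1 := by
    rw [div_lt_one (by positivity)]
    exact_mod_cast Nat.lt_of_lt_of_le (show k + 1 < 2 ^ k by
      induction k, hk using Nat.le_induction with
      | base => norm_num
      | succ k _ ih => rw [pow_succ]; omega) le_rfl
  have h2 : (((k : ℝ) + 1) / 2 ^ k) ^ 3 < 1 := pow_lt_one₀ (by positivity) h (by norm_num)
  unfold pTwo pOne
  linarith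

lemma lt_alphaStar_two : (8 / 5 : ℝ) < alphaStar 2 3 := by
  have h : √(pZero 2 3 * pTwo 2 3) < 6.1 / 64 := by
    rw [Real.sqrt_lt' (by norm_num)]
    norm_num [pTwo, pOne, pZero]
  have h0 := Real.sqrt_nonneg (pZero 2 3 * pTwo 2 3)
  have h1 : pOne 2 3 = 26 / 64 := by norm_num [pOne, pZero]
  unfold alphaStar
  rw [lt_div_iff₀ (by rw [h1]; positivity), h1]
  linarith

lemma lt_alphaStar_three : (4.86 : ℝ) < alphaStar 3 3 := by
  have h : √(pZero 3 3 * pTwo 3 3) < 21.17 / 512 := by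
    rw [Real.sqrt_lt' (by norm_num)]
    norm_num [pTwo, pOne, pZero]
  have h0 := Real.sqrt_nonneg (pZero 3 3 * pTwo 3 3)
  have h1 : pOne 3 3 = 63 / 512 := by norm_num [pOne, pZero]
  unfold alphaStar
  rw [lt_div_iff₀ (by rw [h1]; positivity), h1]
  linarith

lemma lt_alphaStar_of_four_le {k : ℕ} (hk : 4 ≤ k) : 2 ^ k * Real.log 2 < alphaStar k 3 := by
  -- with `x = 2 ^ k`, the terms `p₁` and `2 * √(p₀ * p₂)` of the denominator are at most `1 / (2 * x)`
  have hcube : ((k : ℝ) + 1) ^ 3 * 2 ≤ 4 ^ k := by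
    induction k, hk using Nat.le_induction with
    | base => norm_num
    | succ k hk ih =>
      have hk' : (4 : ℝ) ≤ k := by exact_mod_cast hk
      push_cast
      rw [pow_succ (4 : ℝ) k]
      have : ((k : ℝ) + 1 + 1) ^ 3 ≤ 4 * (k + 1) ^ 3 := by
        nlinarith [pow_le_pow_left₀ (by norm_num) hk' 2, pow_le_pow_left₀ (by norm_num) hk' 3]
      linarith
  have hp2 := pTwo_three_pos (show 2 ≤ k by omega)
  have h0 := pZero_pos k 3
  have h1 := pOne_nonneg k 3
  have hs := pZero_add_pOne_add_pTwo k 3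
  set x : ℝ := 2 ^ k with hx
  have hx16 : 16 ≤ x := by
    calc (16 : ℝ) = 2 ^ 4 := by norm_num
      _ ≤ 2 ^ k := pow_le_pow_right₀ (by norm_num) hk
  have h4x : (4 : ℝ) ^ k = x ^ 2 := by rw [hx, ← pow_mul, mul_comm, pow_mul]; norm_num
  have hpz : pZero k 3 = 1 / x ^ 3 := by rw [pZero, hx, ← pow_mul]
  have hp1 : pOne k 3 ≤ 1 / 2 / x := by
    have : pOne k 3 ≤ (((k : ℝ) + 1) / x) ^ 3 := by unfold pOne; linarith
    refine this.trans ?_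
    rw [div_pow, div_le_div_iff₀ (by positivity) (by positivity)]
    rw [h4x] at hcube
    nlinarith
  have hsq : √(pZero k 3 * pTwo k 3) ≤ 1 / 4 / x := by
    rw [Real.sqrt_le_left (by positivity)]
    have h2 : pZero k 3 * pTwo k 3 ≤ 1 / x ^ 3 := by
      rw [← hpz]; exact mul_le_of_le_one_right h0.le (by linarith)
    refine h2.trans ?_
    rw [div_div, div_pow, div_le_div_iff₀ (by positivity) (by positivity)]
    nlinarith [pow_pos (show 0 < x by linarith) 2]
  have hsq0 : 0 < √(pZero k 3 * pTwo k 3) := Real.sqrt_pos.2 (mul_pos h0 hp2)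
  unfold alphaStar
  rw [lt_div_iff₀ (by linarith)]
  have hlog := Real.log_two_lt_d9
  have hlog0 := Real.log_pos (one_lt_two (α := ℝ))
  have h3 : pOne k 3 + 2 * √(pZero k 3 * pTwo k 3) ≤ 1 / x := by
    have : (1 : ℝ) / x = 1 / 2 / x + 2 * (1 / 4 / x) := by ring
    linarith
  calc x * Real.log 2 * (pOne k 3 + 2 * √(pZero k 3 * pTwo k 3))
      ≤ x * Real.log 2 * (1 / x) := mul_le_mul_of_nonneg_left h3 (by positivity)
    _ = Real.log 2 := by field_simp
    _ < 1 := by linarith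

lemma tendsto_randomSatProb_three :
    Tendsto (fun n : ℕ => randomSatProb 3 n ⌊(4.8 : ℝ) * n⌋₊) atTop (𝓝 0) := by
  refine tendsto_randomSatProb_of_lt_one (by norm_num) (by norm_num) ?_
  -- `(7 / 8) ^ 4.8 < 0.53` and `exp (-14.4 / 7) > 0.12`, checked after raising to powers
  have h1 : (1 - 1 / 2 ^ 3 : ℝ) ^ (4.8 : ℝ) < 0.53 := by
    refine lt_of_pow_lt_pow_left₀ 5 (by norm_num) ?_
    rw [← Real.rpow_natCast, ← Real.rpow_mul (by norm_num)]
    rw [show ((4.8 : ℝ) * (5 : ℕ)) = ((24 : ℕ) : ℝ) by norm_num, Real.rpow_natCast]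
    norm_num
  have h2 : 0.12 < Real.exp (-((3 : ℕ) / (2 ^ 3 - 1))) ^ (4.8 : ℝ) := by
    refine lt_of_pow_lt_pow_left₀ 35 (by positivity) ?_
    rw [← Real.exp_mul, ← Real.exp_nat_mul]
    rw [show ((35 : ℕ) : ℝ) * (-((3 : ℕ) / (2 ^ 3 - 1)) * 4.8) = ((72 : ℕ) : ℝ) * (-1) by norm_num,
      Real.exp_nat_mul, Real.exp_neg]
    have := Real.exp_one_lt_d9
    calc (0.12 : ℝ) ^ 35 < (1 / 2.7182818286) ^ 72 := by norm_num
      _ ≤ (Real.exp 1)⁻¹ ^ 72 := by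
          rw [one_div]
          gcongr
  have h3 : (0 : ℝ) < (1 - 1 / 2 ^ 3 : ℝ) ^ (4.8 : ℝ) := Real.rpow_pos_of_pos (by norm_num) _
  nlinarith

/-- At the density `2 ^ k * log 2` already the first moment of all satisfying assignments is
bounded, and the restriction to locally maximal ones makes it exponentially small. -/
lemma tendsto_randomSatProb_of_four_le {k : ℕ} (hk : 4 ≤ k) :
    Tendsto (fun n : ℕ => randomSatProb k n ⌊2 ^ k * Real.log 2 * n⌋₊) atTop (𝓝 0) := by
  have hlog := Real.log_pos (one_lt_two (α := ℝ))
  refine tendsto_randomSatProb_of_lt_one (by omega) (by positivity) ?_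
  have hx : (1 : ℝ) < 2 ^ k := one_lt_pow₀ (by norm_num) (by omega)
  have h0 : (0 : ℝ) < 1 - 1 / 2 ^ k := by
    rw [sub_pos, div_lt_one (by positivity)]; exact hx
  have h1 : (1 - 1 / 2 ^ k : ℝ) ^ (2 ^ k * Real.log 2) ≤ 1 / 2 := by
    have h2 : (1 - 1 / 2 ^ k : ℝ) ≤ Real.exp (-(1 / 2 ^ k)) := by
      have := Real.add_one_le_exp (-(1 / 2 ^ k : ℝ))
      linarith
    refine (Real.rpow_le_rpow h0.le h2 (by positivity)).trans (le_of_eq ?_)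
    rw [← Real.exp_mul, show -(1 / 2 ^ k : ℝ) * (2 ^ k * Real.log 2) = -Real.log 2 by field_simp,
      Real.exp_neg, Real.exp_log (by norm_num), one_div]
  have h2 : (0 : ℝ) < Real.exp (-(k / (2 ^ k - 1))) ^ (2 ^ k * Real.log 2) :=
    Real.rpow_pos_of_pos (Real.exp_pos _) _
  have h3 : (0 : ℝ) < (1 - 1 / 2 ^ k : ℝ) ^ (2 ^ k * Real.log 2) := Real.rpow_pos_of_pos h0 _
  nlinarith

/-- Above some density below `alphaStar`, random `k`-SAT is unsatisfiable. -/
lemma exists_unsat_density {k : ℕ} (hk : 2 ≤ k) : ∃ c, c < alphaStar k 3 ∧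
    Tendsto (fun n : ℕ => randomSatProb k n ⌊c * n⌋₊) atTop (𝓝 0) := by
  rcases (show k = 2 ∨ k = 3 ∨ 4 ≤ k by omega) with rfl | rfl | hk
  · exact ⟨_, lt_alphaStar_two, tendsto_randomSatProb_two⟩
  · exact ⟨_, lt_trans (by norm_num) lt_alphaStar_three, tendsto_randomSatProb_three⟩
  · exact ⟨_, lt_alphaStar_of_four_le hk, tendsto_randomSatProb_of_four_le hk⟩

/-! ### Three choices raise the threshold -/

lemma exists_isMaxRule : ∃ r : (Fin 3 → ℕ) → Fin 3, IsMaxRule r := by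
  choose r hr using fun a : Fin 3 → ℕ => Finite.exists_max a
  exact ⟨r, fun a j => hr a j⟩

theorem mainTheorem1 (k : ℕ) (hk : 2 ≤ k) :
    -- the most-positive-of-three strategy, with any tie-breaking that looks only at sign counts
    (∀ r : (Fin 3 → ℕ) → Fin 3, IsMaxRule r →
      (∀ n : ℕ, k ≤ n →
        reducedSignProb k r n 0 = pZero k 3 ∧
        reducedSignProb k r n 1 = pOne k 3 ∧
        reducedSignProb k r n 2 = pTwo k 3) ∧
      (∀ α : ℝ, α < alphaStar k 3 →
        Tendsto (fun n : ℕ => (mostPositiveStrategy k r n).reducedSatProb ⌊α * n⌋₊)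
          atTop (𝓝 1) ∧
        Tendsto (fun n : ℕ => (mostPositiveStrategy k r n).satProb ⌊α * n⌋₊)
          atTop (𝓝 1))) ∧
    -- three choices raise the threshold
    (∃ S : (n : ℕ) → OnlineStrategy 3 k n,
      (∃ r : (Fin 3 → ℕ) → Fin 3, IsMaxRule r ∧ S = mostPositiveStrategy k r) ∧
      ∃ α : ℝ, α < alphaStar k 3 ∧
        Tendsto (fun n : ℕ => (S n).satProb ⌊α * n⌋₊) atTop (𝓝 1) ∧
        (∀ β : ℝ, α ≤ β →
          Tendsto (fun n : ℕ => randomSatProb k n ⌊β * n⌋₊) atTop (𝓝 0)) ∧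
        (∀ a : ℝ, IsSatThreshold k a → a < α)) ∧
    -- numerical values
    (k = 3 → 4.86 < alphaStar k 3) ∧
    (4 ≤ k → 2 ^ k * Real.log 2 < alphaStar k 3) := by
  have hsat : ∀ r : (Fin 3 → ℕ) → Fin 3, IsMaxRule r → ∀ α : ℝ, α < alphaStar k 3 →
      Tendsto (fun n : ℕ => (mostPositiveStrategy k r n).satProb ⌊α * n⌋₊) atTop (𝓝 1) :=
    fun r hr α hα => tendsto_of_tendsto_of_tendsto_of_le_of_le
      (tendsto_reducedSatProb hk hr (pTwo_three_pos hk) hα) tendsto_const_nhds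
      (fun n => reducedSatProb_le_satProb _ _) (fun n => satProb_le_one _ _)
  refine ⟨fun r hr => ⟨fun n hkn => reducedSignProb_eq hk hkn hr, fun α hα =>
    ⟨tendsto_reducedSatProb hk hr (pTwo_three_pos hk) hα, hsat r hr α hα⟩⟩, ?_, ?_, ?_⟩
  · obtain ⟨r, hr⟩ := exists_isMaxRule
    obtain ⟨c, hc, hunsat⟩ := exists_unsat_density hk
    have hunsat' : ∀ β, c ≤ β →
        Tendsto (fun n : ℕ => randomSatProb k n ⌊β * n⌋₊) atTop (𝓝 0) := by
      intro β hβ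
      refine tendsto_of_tendsto_of_tendsto_of_le_of_le' tendsto_const_nhds hunsat
        (Eventually.of_forall fun n => randomSatProb_nonneg _ _ _) ?_
      filter_upwards [eventually_ge_atTop k] with n hkn
      exact randomSatProb_antitone hkn
        (Nat.floor_le_floor (mul_le_mul_of_nonneg_right hβ (by positivity)))
    obtain ⟨α, hcα, hα⟩ := exists_between hc
    refine ⟨_, ⟨r, hr, rfl⟩, α, hα, hsat r hr α hα, fun β hβ => hunsat' β (hcα.le.trans hβ), ?_⟩
    intro a ha
    by_contra hlt
    -- at the density `c < α ≤ a` the limit would be both `1` and `0`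
    exact one_ne_zero (tendsto_nhds_unique (ha.1 c (hcα.trans_le (not_lt.1 hlt))) hunsat)
  · rintro rfl
    exact lt_alphaStar_three
  · exact lt_alphaStar_of_four_le
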